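/- Let $H\in(0,3/4)$ and $R_H(s,t)=\tfrac12\left(s^{2H}+t^{2H}-|s-t|^{2H}\right)$ for $s,t\ge 0$. For $T>0$ let $\mathfrak H$ be the canonical Hilbert space of fractional Brownian motion with Hurst parameter $H$ on $[0,T]$, that is, the completion of the step functions on $[0,T]$ for the inner product determined by $\langle \mathbf 1_{[0,s]},\mathbf 1_{[0,t]}\rangle_{\mathfrak H}=R_H(s,t)$, and let $\mathfrak H^{\otimes 2}$ be its Hilbert tensor square, that is, the completion of the span of the functions $\mathbf 1_{[0,s]}\otimes\mathbf 1_{[0,t]}$ on $[0,T]^2$ for $\langle \mathbf 1_{[0,s]}\otimes\mathbf 1_{[0,t]},\mathbf 1_{[0,s']}\otimes\mathbf 1_{[0,t']}\rangle=R_H(s,s')R_H(t,t')$. A square-integrable function is identified with an element of the completion if some sequence of step functions converges to the function in $L^2$ and to the element in the completion. Put $$f_T(t,s)=e^{-|t-s|}\mathbf 1_{\{0\le s,t\le T\}},\qquad h_t(u)=e^{u-t}\mathbf 1_{[0,t]}(u),\qquad b_T=\frac1T\int_0^T\|h_t\|_{\mathfrak H}^2\,dt,$$ $$\sigma_H^2=(4H-1)\Big(1-\frac1{\cos(2\pi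 H)}\Big)\quad (H\ne\tfrac14),\qquad \sigma_{1/4}^2=\frac2\pi .$$ Then there is a constant $C>0$, which may depend on $H$ but not on $T$, such that for every $T>0$ the functions $f_T$ and $h_t$ ($0\le t\le T$) define elements of $\mathfrak H^{\otimes 2}$ and $\mathfrak H$ with well-defined norms, $t\mapsto\|h_t\|_{\mathfrak H}^2$ is integrable on $[0,T]$, and $$\left|\frac{\|f_T\|_{\mathfrak H^{\otimes 2}}^2}{2T}-\sigma_H^2\,b_T^2\right|\le\frac{C}{T^{\,1\wedge(3-4H)}} .$$ -/

import Mathlib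

open MeasureTheory Filter Topology

noncomputable section

namespace FBM

/-! Completion of a space of step functions.

`e i` (`i : ι`) are the generating step functions on a measure space `(α, μ)`, and `K i j` is the
prescribed inner product of `e i` and `e j`. -/

section Completion

variable {ι α : Type*}

/-- The step function `∑ i, φ i • e i`. -/
def stepFun (e : ι → α → ℝ) (φ : ι →₀ ℝ) (x : α) : ℝ :=
  φ.sum fun i c => c * e i x

/-- The inner product of `∑ i, φ i • e i` and `∑ j, ψ j • e j`, extended bilinearly from
`⟨e i, e j⟩ = K i j`. -/
def stepInner (K : ι → ι → ℝ) (φ ψ : ι →₀ ℝ) : ℝ :=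
  φ.sum fun i c => ψ.sum fun j d => c * d * K i j

/-- The function `f` belongs to the completion of the step functions with respect to `stepInner K`,
and its squared norm there is `N`: some sequence of step functions is Cauchy for the inner product,
converges to `f` in `L²(μ)` (this says which function the element of the completion is), and has
squared norms converging to `N`. -/
def IsNormSq (e : ι → α → ℝ) (K : ι → ι → ℝ) [MeasurableSpace α] (μ : Measure α)
    (f : α → ℝ) (N : ℝ) : Prop :=
  ∃ φ : ℕ → (ι →₀ ℝ),
    Tendsto (fun p : ℕ × ℕ => stepInner K (φ p.1 - φ p.2) (φ p.1 - φ p.2)) atTop (𝓝 0) ∧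
    Tendsto (fun n => eLpNorm (fun x => stepFun e (φ n) x - f x) 2 μ) atTop (𝓝 0) ∧
    Tendsto (fun n => stepInner K (φ n) (φ n)) atTop (𝓝 N)

end Completion

/-- The covariance function of fractional Brownian motion with Hurst parameter `H`,
for `s, t ≥ 0`. -/
def cov (H s t : ℝ) : ℝ :=
  (s ^ (2 * H) + t ^ (2 * H) - |s - t| ^ (2 * H)) / 2

/-- The indicator function of `[0, t]`. -/
def ind (t x : ℝ) : ℝ := (Set.Icc (0 : ℝ) t).indicator (fun _ => 1) x

/-- `f` belongs to the canonical Hilbert space `𝔥` of fractional Brownian motion on `[0, T]`, the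
completion of the step functions on `[0, T]` for `⟨1_[0,s], 1_[0,t]⟩ = cov H s t`, and
`‖f‖²_𝔥 = N`. -/
def IsNormSqOne (H T : ℝ) (f : ℝ → ℝ) (N : ℝ) : Prop :=
  IsNormSq (fun (s : Set.Icc (0 : ℝ) T) x => ind s x)
    (fun s t => cov H s t) (volume.restrict (Set.Icc 0 T)) f N

/-- `f` belongs to the Hilbert tensor square `𝔥 ⊗ 𝔥`, the completion of the span of the functions
`1_[0,s] ⊗ 1_[0,t]` on `[0, T]²` for
`⟨1_[0,s] ⊗ 1_[0,t], 1_[0,s'] ⊗ 1_[0,t']⟩ = cov H s s' * cov H t t'`, and `‖f‖²_{𝔥 ⊗ 𝔥} = N`. -/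
def IsNormSqTwo (H T : ℝ) (f : ℝ × ℝ → ℝ) (N : ℝ) : Prop :=
  IsNormSq
    (fun (p : Set.Icc (0 : ℝ) T × Set.Icc (0 : ℝ) T) (x : ℝ × ℝ) => ind p.1 x.1 * ind p.2 x.2)
    (fun p q => cov H p.1 q.1 * cov H p.2 q.2)
    (volume.restrict (Set.Icc 0 T ×ˢ Set.Icc 0 T)) f N

/-- `‖f‖²_𝔥`: the only element of the set, for every `f` in `𝔥`. -/
def normSqOne (H T : ℝ) (f : ℝ → ℝ) : ℝ := sInf {N | IsNormSqOne H T f N}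

/-- `‖f‖²_{𝔥 ⊗ 𝔥}`: the only element of the set, for every `f` in `𝔥 ⊗ 𝔥`. -/
def normSqTwo (H T : ℝ) (f : ℝ × ℝ → ℝ) : ℝ := sInf {N | IsNormSqTwo H T f N}

/-- `f_T(t, s) = e^{-|t - s|} 1_{0 ≤ s, t ≤ T}`. -/
def fT (T : ℝ) : ℝ × ℝ → ℝ :=
  (Set.Icc (0 : ℝ) T ×ˢ Set.Icc (0 : ℝ) T).indicator fun p => Real.exp (-|p.1 - p.2|)

/-- `h_t(u) = e^{u - t} 1_[0,t](u)`. -/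
def hT (t : ℝ) : ℝ → ℝ :=
  (Set.Icc (0 : ℝ) t).indicator fun u => Real.exp (u - t)

/-- `b_T = (1 / T) ∫₀ᵀ ‖h_t‖²_𝔥 dt`. -/
def bT (H T : ℝ) : ℝ := (1 / T) * ∫ t in (0 : ℝ)..T, normSqOne H T (hT t)

/-- `σ_H² = (4H - 1)(1 - 1 / cos(2πH))`, extended by continuity (value `2 / π`) to `H = 1/4`, where
`cos(2πH)` and `4H - 1` both vanish. -/
def sigmaSq (H : ℝ) : ℝ :=
  if H = 1 / 4 then 2 / Real.pi
  else (4 * H - 1) * (1 - 1 / Real.cos (2 * H * Real.pi))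

end FBM

end

/-! Everything is computed in a real spectral model. The covariance of fractional Brownian motion is
the Gram matrix in `specMeas H`, of density `c|ξ|^(1-2H)`, of the Hartley transforms of the
functions `1_[0,s]`. A real transform suffices because the density is even. On `[0,T]` the transform
at each `ξ` is the pairing with a fixed `L²` function, so the map from step functions to the
spectral space is closable. Hence an `L²` function has at most one norm in the completion, that of
its transform (`isNormSq_iff`); the same holds for the tensor square.

Membership comes from Bochner integrals of generators: `h_t = 1_[0,t] - ∫₀ᵗ e^(s-t) 1_[0,s] ds` and
`f_T = h_T ⊗ h_T + 2 ∫₀ᵀ h_t ⊗ h_t dt`. With `ρ(s,t) = ⟪h_s, h_t⟫` (`covOU`), expanding the square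
gives `‖f_T‖² = ρ(T,T)² + 4 ∫ ρ(T,t)² dt + 4 ∬ ρ(s,t)² ds dt`.

The spectral formula shows that `ρ(s,t)` equals `r(t-s)` up to exponentially damped terms
(`covOU_eq`), where `r` (`ouCov`) is the stationary covariance, of density `c|ξ|^(1-2H)/(1+ξ²)`.
Replacing `ρ` by `r` costs `O(1)` in the double integral, and `∬ r(t-s)²` is `T ∫ r²` minus twice
the integral over `[0,T]` of the tail of `∫ r²`. Writing `r` as an average of second differences of
`|·|^(2H)` gives `|r(u)| ≤ u^(2H-2)`, hence tails of order `s^(4H-3)` and the rate `1 ∧ (3-4H)`; at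
`H = 1/2` this would lose a logarithm, and a sharper bound is used.

For the constant, Plancherel turns `∫ r²` into the integral of the squared density; this integral
and `r(0)` are Beta integrals, and the reflection formula yields `2 ∫ r² = σ_H² r(0)²`
(`two_mul_integral_ouCov_sq`). Since `b_T = r(0) + O(1/T)`, the estimate follows for large `T`; for
`T ≤ 1` crude bounds are enough. -/

open scoped RealInnerProductSpace

noncomputable section

namespace FBM

/-! ### Closability and norms through a closed graph -/

section Graph

variable {ι α β : Type*} [MeasurableSpace α] [MeasurableSpace β] {μ : Measure α} {ν : Measure β}
  {e : ι → α → ℝ}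

/-- The vector `(e i, d i)`, a point of the graph of the feature map. -/
def graphVec (he : ∀ i, MemLp (e i) 2 μ) (d : ι → Lp ℝ 2 ν) (i : ι) : Lp ℝ 2 μ × Lp ℝ 2 ν :=
  ((he i).toLp (e i), d i)

/-- The closed graph of the feature map `e i ↦ d i`. -/
def closedGraph (he : ∀ i, MemLp (e i) 2 μ) (d : ι → Lp ℝ 2 ν) :
    Submodule ℝ (Lp ℝ 2 μ × Lp ℝ 2 ν) :=
  (Submodule.span ℝ (Set.range (graphVec he d))).topologicalClosure

variable {he : ∀ i, MemLp (e i) 2 μ} {d : ι → Lp ℝ 2 ν} {K : ι → ι → ℝ}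

lemma graphVec_mem_closedGraph (i : ι) : graphVec he d i ∈ closedGraph he d :=
  Submodule.le_topologicalClosure _ (Submodule.subset_span ⟨i, rfl⟩)

lemma linearCombination_graphVec_mem (φ : ι →₀ ℝ) :
    Finsupp.linearCombination ℝ (graphVec he d) φ ∈ closedGraph he d :=
  Submodule.le_topologicalClosure _
    (Finsupp.mem_span_range_iff_exists_finsupp.2 ⟨φ, rfl⟩)

lemma exists_tendsto_linearCombination {x : Lp ℝ 2 μ × Lp ℝ 2 ν} (hx : x ∈ closedGraph he d) :
    ∃ φ : ℕ → (ι →₀ ℝ),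
      Tendsto (fun n => Finsupp.linearCombination ℝ (graphVec he d) (φ n)) atTop (𝓝 x) := by
  have hx' : x ∈ closure (Submodule.span ℝ (Set.range (graphVec he d)) : Set _) := hx
  obtain ⟨y, hy, hyx⟩ := mem_closure_iff_seq_limit.1 hx'
  have : ∀ n, ∃ φ : ι →₀ ℝ, Finsupp.linearCombination ℝ (graphVec he d) φ = y n := fun n =>
    Finsupp.mem_span_range_iff_exists_finsupp.1 (hy n)
  choose φ hφ using this
  exact ⟨φ, by simpa only [hφ] using hyx⟩

lemma linearCombination_graphVec_fst (φ : ι →₀ ℝ) :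
    (Finsupp.linearCombination ℝ (graphVec he d) φ).1
      = ∑ i ∈ φ.support, φ i • (he i).toLp (e i) := by
  simp [Finsupp.linearCombination_apply, Finsupp.sum, Prod.fst_sum, graphVec]

lemma linearCombination_graphVec_snd (φ : ι →₀ ℝ) :
    (Finsupp.linearCombination ℝ (graphVec he d) φ).2 = ∑ i ∈ φ.support, φ i • d i := by
  simp [Finsupp.linearCombination_apply, Finsupp.sum, Prod.snd_sum, graphVec]

lemma linearCombination_graphVec_fst_ae (φ : ι →₀ ℝ) :
    (Finsupp.linearCombination ℝ (graphVec he d) φ).1 =ᵐ[μ] stepFun e φ := by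
  rw [linearCombination_graphVec_fst]
  have h1 : ∀ i ∈ φ.support,
      (φ i • (he i).toLp (e i) : Lp ℝ 2 μ) =ᵐ[μ] fun x => φ i * e i x := fun i _ => by
    filter_upwards [Lp.coeFn_smul (φ i) ((he i).toLp (e i)), (he i).coeFn_toLp] with x h1 h2
    rw [h1, Pi.smul_apply, h2, smul_eq_mul]
  have h2 : ∀ᵐ x ∂μ, ∀ i ∈ φ.support, (φ i • (he i).toLp (e i) : Lp ℝ 2 μ) x = φ i * e i x :=
    (Finset.eventually_all _).2 h1
  filter_upwards [h2, Lp.coeFn_finsetSum φ.support fun i => φ i • (he i).toLp (e i)] with x hx hs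
  rw [hs, Finset.sum_apply, stepFun, Finsupp.sum]
  exact Finset.sum_congr rfl hx

lemma stepInner_eq_inner (hK : ∀ i j, ⟪d i, d j⟫ = K i j) (φ ψ : ι →₀ ℝ) :
    stepInner K φ ψ = ⟪(Finsupp.linearCombination ℝ (graphVec he d) φ).2,
      (Finsupp.linearCombination ℝ (graphVec he d) ψ).2⟫ := by
  simp only [linearCombination_graphVec_snd, stepInner, Finsupp.sum, sum_inner, inner_sum,
    real_inner_smul_left, real_inner_smul_right, hK]
  rw [Finset.sum_comm]
  exact Finset.sum_congr rfl fun i _ => Finset.sum_congr rfl fun j _ => by ring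

lemma linearCombination_graphVec_snd_ae {k : β → Lp ℝ 2 μ}
    (hk : ∀ i, d i =ᵐ[ν] fun ξ => ⟪k ξ, (he i).toLp (e i)⟫) (φ : ι →₀ ℝ) :
    (Finsupp.linearCombination ℝ (graphVec he d) φ).2 =ᵐ[ν]
      fun ξ => ⟪k ξ, (Finsupp.linearCombination ℝ (graphVec he d) φ).1⟫ := by
  simp only [linearCombination_graphVec_snd, linearCombination_graphVec_fst, inner_sum,
    real_inner_smul_right]
  have h1 : ∀ i ∈ φ.support,
      (φ i • d i : Lp ℝ 2 ν) =ᵐ[ν] fun ξ => φ i * ⟪k ξ, (he i).toLp (e i)⟫ := fun i _ => by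
    filter_upwards [Lp.coeFn_smul (φ i) (d i), hk i] with x h1 h2
    rw [h1, Pi.smul_apply, h2, smul_eq_mul]
  have h2 : ∀ᵐ x ∂ν, ∀ i ∈ φ.support,
      (φ i • d i : Lp ℝ 2 ν) x = φ i * ⟪k x, (he i).toLp (e i)⟫ :=
    (Finset.eventually_all _).2 h1
  filter_upwards [h2, Lp.coeFn_finsetSum φ.support fun i => φ i • d i] with x hx hs
  rw [hs, Finset.sum_apply]
  exact Finset.sum_congr rfl hx

/-- The closed graph is the graph of the integral operator with kernel `k`. -/
lemma snd_ae_of_mem_closedGraph {k : β → Lp ℝ 2 μ}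
    (hk : ∀ i, d i =ᵐ[ν] fun ξ => ⟪k ξ, (he i).toLp (e i)⟫)
    {x : Lp ℝ 2 μ × Lp ℝ 2 ν} (hx : x ∈ closedGraph he d) :
    x.2 =ᵐ[ν] fun ξ => ⟪k ξ, x.1⟫ := by
  obtain ⟨φ, hφ⟩ := exists_tendsto_linearCombination hx
  have h1 := (continuous_fst.tendsto x).comp hφ
  have h2 := (continuous_snd.tendsto x).comp hφ
  have h3 := tendstoInMeasure_of_tendsto_Lp h2
  -- Along a subsequence the second coordinates converge almost everywhere, while the pairings with
  -- `k ξ` converge at every `ξ`, since the first coordinates converge in `L²`.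
  obtain ⟨ns, hns, hae⟩ := h3.exists_seq_tendsto_ae
  have h4 : ∀ᵐ ξ ∂ν, ∀ n, (Finsupp.linearCombination ℝ (graphVec he d) (φ n)).2 ξ
      = ⟪k ξ, (Finsupp.linearCombination ℝ (graphVec he d) (φ n)).1⟫ :=
    ae_all_iff.2 fun n => linearCombination_graphVec_snd_ae hk (φ n)
  filter_upwards [hae, h4] with ξ hξ h4ξ
  have h5 : Tendsto (fun i => ⟪k ξ, (Finsupp.linearCombination ℝ (graphVec he d) (φ (ns i))).1⟫)
      atTop (𝓝 ⟪k ξ, x.1⟫) :=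
    (Tendsto.inner tendsto_const_nhds h1).comp hns.tendsto_atTop
  refine tendsto_nhds_unique hξ ?_
  simpa only [Function.comp_def, h4ξ] using h5

lemma stepInner_sub_self (hK : ∀ i j, ⟪d i, d j⟫ = K i j) (φ ψ : ι →₀ ℝ) :
    stepInner K (φ - ψ) (φ - ψ) = dist (Finsupp.linearCombination ℝ (graphVec he d) φ).2
      (Finsupp.linearCombination ℝ (graphVec he d) ψ).2 ^ 2 := by
  rw [stepInner_eq_inner (he := he) hK, map_sub, Prod.snd_sub, real_inner_self_eq_norm_sq,
    dist_eq_norm]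

lemma eLpNorm_stepFun_sub {f : α → ℝ} (hf : MemLp f 2 μ) (φ : ι →₀ ℝ) :
    eLpNorm (fun x => stepFun e φ x - f x) 2 μ
      = edist (Finsupp.linearCombination ℝ (graphVec he d) φ).1 (hf.toLp f) := by
  rw [Lp.edist_def]
  refine eLpNorm_congr_ae ?_
  filter_upwards [linearCombination_graphVec_fst_ae (he := he) (d := d) φ, hf.coeFn_toLp]
    with x h1 h2
  simp [h1, h2]

lemma isNormSq_of_mem_closedGraph (hK : ∀ i j, ⟪d i, d j⟫ = K i j) {f : α → ℝ}
    (hf : MemLp f 2 μ) {w : Lp ℝ 2 ν} (hw : (hf.toLp f, w) ∈ closedGraph he d) :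
    IsNormSq e K μ f (‖w‖ ^ 2) := by
  obtain ⟨φ, hφ⟩ := exists_tendsto_linearCombination hw
  have h1 := (continuous_fst.tendsto _).comp hφ
  have h2 := (continuous_snd.tendsto _).comp hφ
  refine ⟨φ, ?_, ?_, ?_⟩
  · simp only [stepInner_sub_self (he := he) hK]
    have h3 := h2.cauchySeq
    rw [cauchySeq_iff_tendsto_dist_atTop_0] at h3
    simpa using h3.pow 2
  · simp only [eLpNorm_stepFun_sub (he := he) (d := d) hf]
    exact tendsto_iff_edist_tendsto_0.1 h1
  · simp only [stepInner_eq_inner (he := he) hK, real_inner_self_eq_norm_sq]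
    exact (h2.norm).pow 2

/-- A sequence that is Cauchy for `stepInner` has Cauchy feature images; completeness gives a limit
`w`, and the pair of limits stays in the closed graph. -/
lemma exists_mem_closedGraph_of_isNormSq (hK : ∀ i j, ⟪d i, d j⟫ = K i j) {f : α → ℝ}
    (hf : MemLp f 2 μ) {N : ℝ} (h : IsNormSq e K μ f N) :
    ∃ w : Lp ℝ 2 ν, (hf.toLp f, w) ∈ closedGraph he d ∧ N = ‖w‖ ^ 2 := by
  obtain ⟨φ, h1, h2, h3⟩ := h
  simp only [stepInner_sub_self (he := he) hK] at h1
  simp only [eLpNorm_stepFun_sub (he := he) (d := d) hf] at h2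
  simp only [stepInner_eq_inner (he := he) hK, real_inner_self_eq_norm_sq] at h3
  have hc : CauchySeq fun n => (Finsupp.linearCombination ℝ (graphVec he d) (φ n)).2 := by
    rw [cauchySeq_iff_tendsto_dist_atTop_0]
    simpa [Real.sqrt_sq dist_nonneg] using h1.sqrt
  obtain ⟨w, hw⟩ := cauchySeq_tendsto_of_complete hc
  refine ⟨w, ?_, tendsto_nhds_unique h3 (hw.norm.pow 2)⟩
  have h4 := (tendsto_iff_edist_tendsto_0.2 h2).prodMk_nhds hw
  exact (Submodule.isClosed_topologicalClosure _).mem_of_tendsto h4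
    (Eventually.of_forall fun n => linearCombination_graphVec_mem (φ n))

/-- Closability: the squared norm of an element of the completion is that of its transform. -/
theorem isNormSq_iff (hK : ∀ i j, ⟪d i, d j⟫ = K i j) {k : β → Lp ℝ 2 μ}
    (hk : ∀ i, d i =ᵐ[ν] fun ξ => ⟪k ξ, (he i).toLp (e i)⟫) {f : α → ℝ}
    (hf : MemLp f 2 μ) {w : Lp ℝ 2 ν} (hw : (hf.toLp f, w) ∈ closedGraph he d) (N : ℝ) :
    IsNormSq e K μ f N ↔ N = ‖w‖ ^ 2 := by
  refine ⟨fun h => ?_, fun h => h ▸ isNormSq_of_mem_closedGraph hK hf hw⟩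
  obtain ⟨w', hw', rfl⟩ := exists_mem_closedGraph_of_isNormSq (he := he) hK hf h
  -- Both second coordinates are the same integral transform of `f`, so the graph has only one point
  -- above `f`.
  have : w' = w := Lp.ext
    ((snd_ae_of_mem_closedGraph hk hw').trans (snd_ae_of_mem_closedGraph hk hw).symm)
  rw [this]

end Graph

/-! ### Tensor products of square-integrable functions -/

section Tensor

variable {α β : Type*} [MeasurableSpace α] [MeasurableSpace β] {μ : Measure α} {ν : Measure β}

lemma inner_toLp_toLp {f g : α → ℝ} (hf : MemLp f 2 μ) (hg : MemLp g 2 μ) :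
    ⟪hf.toLp f, hg.toLp g⟫ = ∫ x, f x * g x ∂μ := by
  rw [L2.inner_def]
  refine integral_congr_ae ?_
  filter_upwards [hf.coeFn_toLp, hg.coeFn_toLp] with x h1 h2
  simp [h1, h2, mul_comm]

lemma inner_Lp_eq_integral (f g : Lp ℝ 2 μ) : ⟪f, g⟫ = ∫ x, f x * g x ∂μ := by
  rw [L2.inner_def]
  exact integral_congr_ae (Eventually.of_forall fun x => by simp [mul_comm])

lemma memLp_prodMul [SFinite ν] {f : α → ℝ} {g : β → ℝ} (hf : MemLp f 2 μ) (hg : MemLp g 2 ν) :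
    MemLp (fun z : α × β => f z.1 * g z.2) 2 (μ.prod ν) := by
  have hm : AEStronglyMeasurable (fun z : α × β => f z.1 * g z.2) (μ.prod ν) :=
    hf.1.comp_fst.mul hg.1.comp_snd
  exact (memLp_two_iff_integrable_sq hm).2 ((hf.integrable_sq.mul_prod hg.integrable_sq).congr
    (Eventually.of_forall fun z => (mul_pow _ _ 2).symm))

lemma prodMul_congr_ae {f f' : α → ℝ} {g g' : β → ℝ} (hf : f =ᵐ[μ] f') (hg : g =ᵐ[ν] g') :
    (fun z : α × β => f z.1 * g z.2) =ᵐ[μ.prod ν] fun z => f' z.1 * g' z.2 := by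
  filter_upwards [Measure.quasiMeasurePreserving_fst.ae_eq_comp hf,
    Measure.quasiMeasurePreserving_snd.ae_eq_comp hg] with z h1 h2
  simp only [Function.comp_apply] at h1 h2
  rw [h1, h2]

variable [SFinite μ] [SFinite ν]

lemma norm_toLp_prodMul (f : Lp ℝ 2 μ) (g : Lp ℝ 2 ν) :
    ‖(memLp_prodMul (Lp.memLp f) (Lp.memLp g)).toLp‖ = ‖f‖ * ‖g‖ := by
  rw [← sq_eq_sq₀ (norm_nonneg _) (by positivity), mul_pow, ← real_inner_self_eq_norm_sq,
    ← real_inner_self_eq_norm_sq, ← real_inner_self_eq_norm_sq, inner_toLp_toLp,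
    inner_Lp_eq_integral, inner_Lp_eq_integral, ← integral_prod_mul]
  exact integral_congr_ae (Eventually.of_forall fun z => by ring)

variable (μ ν) in
/-- The tensor product `f ⊗ g` of square-integrable functions, as a bilinear map. -/
def tensorL : Lp ℝ 2 μ →L[ℝ] Lp ℝ 2 ν →L[ℝ] Lp ℝ 2 (μ.prod ν) :=
  LinearMap.mkContinuous₂ (LinearMap.mk₂ ℝ
    (fun (f : Lp ℝ 2 μ) (g : Lp ℝ 2 ν) => (memLp_prodMul (Lp.memLp f) (Lp.memLp g)).toLp)
    (fun f f' g => by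
      rw [← MemLp.toLp_add]
      refine MemLp.toLp_congr _ _ ((prodMul_congr_ae (Lp.coeFn_add f f') (ae_eq_refl g)).trans ?_)
      exact Eventually.of_forall fun z => by simp [add_mul])
    (fun c f g => by
      rw [← MemLp.toLp_const_smul]
      refine MemLp.toLp_congr _ _ ((prodMul_congr_ae (Lp.coeFn_smul c f) (ae_eq_refl g)).trans ?_)
      exact Eventually.of_forall fun z => by simp [mul_assoc])
    (fun f g g' => by
      rw [← MemLp.toLp_add]
      refine MemLp.toLp_congr _ _ ((prodMul_congr_ae (ae_eq_refl f) (Lp.coeFn_add g g')).trans ?_)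
      exact Eventually.of_forall fun z => by simp [mul_add])
    (fun c f g => by
      rw [← MemLp.toLp_const_smul]
      refine MemLp.toLp_congr _ _ ((prodMul_congr_ae (ae_eq_refl f) (Lp.coeFn_smul c g)).trans ?_)
      exact Eventually.of_forall fun z => by simp [mul_left_comm]))
    1 (fun f g => by rw [one_mul]; exact (norm_toLp_prodMul f g).le)

lemma coeFn_tensorL (f : Lp ℝ 2 μ) (g : Lp ℝ 2 ν) :
    tensorL μ ν f g =ᵐ[μ.prod ν] fun z => f z.1 * g z.2 :=
  (memLp_prodMul (Lp.memLp f) (Lp.memLp g)).coeFn_toLp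

lemma tensorL_toLp {f : α → ℝ} {g : β → ℝ} (hf : MemLp f 2 μ) (hg : MemLp g 2 ν) :
    tensorL μ ν (hf.toLp f) (hg.toLp g) = (memLp_prodMul hf hg).toLp _ :=
  MemLp.toLp_congr (memLp_prodMul (Lp.memLp _) (Lp.memLp _)) _ (prodMul_congr_ae hf.coeFn_toLp hg.coeFn_toLp)

lemma inner_tensorL (f f' : Lp ℝ 2 μ) (g g' : Lp ℝ 2 ν) :
    ⟪tensorL μ ν f g, tensorL μ ν f' g'⟫ = ⟪f, f'⟫ * ⟪g, g'⟫ := by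
  refine (inner_toLp_toLp (memLp_prodMul (Lp.memLp f) (Lp.memLp g))
    (memLp_prodMul (Lp.memLp f') (Lp.memLp g'))).trans ?_
  rw [inner_Lp_eq_integral, inner_Lp_eq_integral, ← integral_prod_mul]
  exact integral_congr_ae (Eventually.of_forall fun z => by ring)

end Tensor

section TensorGraph

variable {ι ι' α α' β β' : Type*} [MeasurableSpace α] [MeasurableSpace β] [MeasurableSpace α']
  [MeasurableSpace β'] {μ : Measure α} {ν : Measure β} {μ' : Measure α'} {ν' : Measure β'}
  [SFinite μ] [SFinite ν] [SFinite μ'] [SFinite ν']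
  {e : ι → α → ℝ} {e' : ι' → α' → ℝ} {d : ι → Lp ℝ 2 ν} {d' : ι' → Lp ℝ 2 ν'}

/-- Closed graphs are compatible with tensor products. -/
lemma tensorL_mem_closedGraph {he : ∀ i, MemLp (e i) 2 μ} {he' : ∀ i, MemLp (e' i) 2 μ'}
    {x : Lp ℝ 2 μ × Lp ℝ 2 ν} {y : Lp ℝ 2 μ' × Lp ℝ 2 ν'}
    (hx : x ∈ closedGraph he d) (hy : y ∈ closedGraph he' d') :
    (tensorL μ μ' x.1 y.1, tensorL ν ν' x.2 y.2) ∈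
      closedGraph (fun p : ι × ι' => memLp_prodMul (he p.1) (he' p.2))
        fun p => tensorL ν ν' (d p.1) (d' p.2) := by
  set G := closedGraph (fun p : ι × ι' => memLp_prodMul (he p.1) (he' p.2))
        fun p => tensorL ν ν' (d p.1) (d' p.2) with hG
  have hGc : IsClosed (G : Set (Lp ℝ 2 (μ.prod μ') × Lp ℝ 2 (ν.prod ν'))) :=
    Submodule.isClosed_topologicalClosure _
  -- The closure is taken one factor at a time: first with the second factor a generator, then with
  -- the first factor an arbitrary point of its closed graph.
  have h1 : ∀ j, closedGraph he d ≤ G.comap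
      ((((tensorL μ μ').flip (graphVec he' d' j).1).prodMap
        ((tensorL ν ν').flip (graphVec he' d' j).2)) :
        Lp ℝ 2 μ × Lp ℝ 2 ν →L[ℝ] Lp ℝ 2 (μ.prod μ') × Lp ℝ 2 (ν.prod ν')).toLinearMap := by
    intro j
    refine Submodule.topologicalClosure_minimal _ (Submodule.span_le.2 ?_)
      (hGc.preimage (ContinuousLinearMap.continuous _))
    rintro _ ⟨i, rfl⟩
    have := graphVec_mem_closedGraph (he := fun p : ι × ι' => memLp_prodMul (he p.1) (he' p.2))
      (d := fun p => tensorL ν ν' (d p.1) (d' p.2)) (i, j)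
    simpa [graphVec, tensorL_toLp] using this
  have h2 : closedGraph he' d' ≤ G.comap
      (((tensorL μ μ' x.1).prodMap (tensorL ν ν' x.2)) :
        Lp ℝ 2 μ' × Lp ℝ 2 ν' →L[ℝ] Lp ℝ 2 (μ.prod μ') × Lp ℝ 2 (ν.prod ν')).toLinearMap := by
    refine Submodule.topologicalClosure_minimal _ (Submodule.span_le.2 ?_)
      (hGc.preimage (ContinuousLinearMap.continuous _))
    rintro _ ⟨j, rfl⟩
    simpa using h1 j hx
  simpa using h2 hy

end TensorGraph

/-! ### Bochner integrals in closed subspaces and in `L²` -/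

section Bochner

variable {X α : Type*} [MeasurableSpace X] [MeasurableSpace α] {τ : Measure X} {μ : Measure α}

/-- In the quotient by `p` the integrand vanishes almost everywhere, hence so does the class of the
integral. A non-integrable `F` has integral `0` by convention. -/
lemma integral_mem_of_isClosed {E : Type*} [NormedAddCommGroup E] [NormedSpace ℝ E]
    [CompleteSpace E] {p : Submodule ℝ E} (hp : IsClosed (p : Set E)) {F : X → E}
    (hF : ∀ᵐ x ∂τ, F x ∈ p) : ∫ x, F x ∂τ ∈ p := by
  by_cases hi : Integrable F τ
  · have : CompleteSpace p := hp.completeSpace_coe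
    have : IsClosed (p : Set E) := hp
    have h := (p.mkQL).integral_comp_comm hi
    have h0 : ∫ x, p.mkQL (F x) ∂τ = 0 := by
      rw [integral_congr_ae (g := fun _ => (0 : E ⧸ p))]
      · simp
      · filter_upwards [hF] with x hx
        simpa using hx
    rw [h0] at h
    simpa using h.symm
  · rw [integral_undef hi]
    exact p.zero_mem

/-- An `L²`-valued Bochner integral is computed pointwise. -/
lemma coeFn_integral_ae [SFinite τ] [IsFiniteMeasure μ] {F : X → Lp ℝ 2 μ} (hF : Integrable F τ)
    {f : X → α → ℝ} (hf : Integrable (Function.uncurry f) (τ.prod μ))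
    (h : ∀ᵐ t ∂τ, F t =ᵐ[μ] f t) :
    ⇑(∫ t, F t ∂τ) =ᵐ[μ] fun x => ∫ t, f t x ∂τ := by
  have hsw : Integrable (fun x => ∫ t, f t x ∂τ) μ := hf.integral_prod_right
  refine Integrable.ae_eq_of_forall_setIntegral_eq _ _
    ((Lp.memLp _).integrable one_le_two) hsw fun s hs hμs => ?_
  -- Integration over `s` is a continuous functional on `L²`, so it passes under the Bochner
  -- integral; Fubini then does the rest.
  rw [← L2.inner_indicatorConstLp_one (𝕜 := ℝ) hs hμs.ne, ← integral_inner hF]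
  simp_rw [L2.inner_indicatorConstLp_one (𝕜 := ℝ) hs hμs.ne]
  rw [← integral_integral_swap (f := f) (μ := τ) (ν := μ.restrict s)]
  · refine integral_congr_ae ?_
    filter_upwards [h] with t ht
    exact integral_congr_ae (ae_restrict_of_ae ht)
  · exact hf.mono_measure (by
      rw [show τ.prod (μ.restrict s) = (τ.prod μ).restrict (Set.univ ×ˢ s) by
        rw [← Measure.prod_restrict, Measure.restrict_univ]]
      exact Measure.restrict_le_self)

end Bochner

/-! ### Spectral representation of fractional Brownian motion -/

section Spectral

lemma integrable_comp_abs {f : ℝ → ℝ} (hf : IntegrableOn f (Set.Ioi 0)) :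
    Integrable fun x => f |x| := by
  have h1 : IntegrableOn (fun x => f |x|) (Set.Ioi 0) :=
    hf.congr_fun (fun x hx => by simp [abs_of_pos (Set.mem_Ioi.1 hx)]) measurableSet_Ioi
  have h2 : IntegrableOn (fun x => f |x|) (Set.Iic 0) := by
    rw [← integrableOn_Ici_iff_integrableOn_Ioi] at h1
    have := h1.comp_neg
    simpa using this
  simpa using h2.union h1

/-- The integrand of the spectral representation of `|s|^{2H}`. -/
def osc (H s ξ : ℝ) : ℝ := (1 - Real.cos (s * ξ)) * |ξ| ^ (-1 - 2 * H)

lemma osc_nonneg (H s ξ : ℝ) : 0 ≤ osc H s ξ :=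
  mul_nonneg (sub_nonneg.2 (Real.cos_le_one _)) (by positivity)

variable {H : ℝ}

lemma integrable_osc_one (h0 : 0 < H) (h1 : H < 1) : Integrable (osc H 1) := by
  have h : IntegrableOn (fun x : ℝ => (1 - Real.cos x) * x ^ (-1 - 2 * H)) (Set.Ioi 0) := by
    have hm : Measurable (fun x : ℝ => (1 - Real.cos x) * x ^ (-1 - 2 * H)) := by fun_prop
    rw [← Set.Ioc_union_Ioi_eq_Ioi zero_le_one]
    -- Near `0` the bound `1 - cos x ≤ x²/2` leaves `x^(1-2H)`, integrable since `H < 1`; at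
    -- infinity `x^(-1-2H)` is integrable since `H > 0`.
    refine IntegrableOn.union ?_ ?_
    · have hi : IntegrableOn (fun x : ℝ => x ^ (1 - 2 * H)) (Set.Ioc 0 1) :=
        (intervalIntegrable_iff_integrableOn_Ioc_of_le zero_le_one).1
          (intervalIntegral.intervalIntegrable_rpow' (by linarith))
      refine hi.mono' hm.aestronglyMeasurable ?_
      filter_upwards [ae_restrict_mem measurableSet_Ioc] with x hx
      have hx0 : 0 < x := hx.1
      rw [Real.norm_eq_abs, abs_of_nonneg (mul_nonneg (sub_nonneg.2 (Real.cos_le_one _))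
        (by positivity)), show 1 - 2 * H = 2 + (-1 - 2 * H) by ring, Real.rpow_add hx0]
      gcongr
      have := Real.one_sub_sq_div_two_le_cos (x := x)
      rw [Real.rpow_two]
      nlinarith [sq_nonneg x]
    · have hi : IntegrableOn (fun x : ℝ => 2 * x ^ (-1 - 2 * H)) (Set.Ioi 1) :=
        (integrableOn_Ioi_rpow_of_lt (by linarith) zero_lt_one).const_mul 2
      refine hi.mono' hm.aestronglyMeasurable ?_
      filter_upwards [ae_restrict_mem measurableSet_Ioi] with x hx
      have hx0 : 0 < x := zero_lt_one.trans hx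
      rw [Real.norm_eq_abs, abs_of_nonneg (mul_nonneg (sub_nonneg.2 (Real.cos_le_one _))
        (by positivity))]
      gcongr
      linarith [Real.neg_one_le_cos x]
  refine (integrable_comp_abs h).congr (Eventually.of_forall fun x => ?_)
  simp [osc]

lemma osc_eq (s : ℝ) (hs : s ≠ 0) (ξ : ℝ) :
    osc H s ξ = |s| ^ (1 + 2 * H) * osc H 1 (s * ξ) := by
  have h : |s| ^ (1 + 2 * H) * |s| ^ (-1 - 2 * H) = 1 := by
    rw [← Real.rpow_add (abs_pos.2 hs)]
    simp
  simp only [osc, one_mul, abs_mul]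
  rw [Real.mul_rpow (abs_nonneg _) (abs_nonneg _)]
  linear_combination (-(1 - Real.cos (s * ξ)) * |ξ| ^ (-1 - 2 * H)) * h

lemma integrable_osc (h0 : 0 < H) (h1 : H < 1) (s : ℝ) : Integrable (osc H s) := by
  rcases eq_or_ne s 0 with rfl | hs
  · simp [show osc H 0 = fun _ => 0 from funext fun x => by
      simp [osc]]
  · rw [show osc H s = fun ξ => |s| ^ (1 + 2 * H) * osc H 1 (s * ξ) from funext (osc_eq s hs)]
    exact ((integrable_comp_mul_left_iff _ hs).2 (integrable_osc_one h0 h1)).const_mul _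

lemma integral_osc_eq (h0 : 0 < H) (s : ℝ) :
    ∫ ξ, osc H s ξ = |s| ^ (2 * H) * ∫ ξ, osc H 1 ξ := by
  rcases eq_or_ne s 0 with rfl | hs
  · simp [osc, Real.zero_rpow (show 2 * H ≠ 0 by positivity)]
  · rw [show osc H s = fun ξ => |s| ^ (1 + 2 * H) * osc H 1 (s * ξ) from funext (osc_eq s hs),
      integral_const_mul, Measure.integral_comp_mul_left (osc H 1), smul_eq_mul, ← mul_assoc,
      Real.rpow_add (abs_pos.2 hs), Real.rpow_one, abs_inv]
    have : |s| ≠ 0 := abs_ne_zero.2 hs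
    field_simp

lemma integral_osc_one_pos (h0 : 0 < H) (h1 : H < 1) : 0 < ∫ ξ, osc H 1 ξ := by
  rw [integral_pos_iff_support_of_nonneg (osc_nonneg H 1) (integrable_osc_one h0 h1)]
  refine lt_of_lt_of_le (by simp) (measure_mono (s := Set.Ioo (0 : ℝ) 1) fun x hx => ?_)
  have hx0 : 0 < x := hx.1
  have hc : Real.cos x ≠ 1 := fun h => by
    have := (Real.cos_eq_one_iff_of_lt_of_lt (by linarith [Real.pi_gt_three])
      (by linarith [Real.pi_gt_three, hx.2])).1 h
    exact hx0.ne' this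
  simp only [Function.mem_support, osc, one_mul]
  exact mul_ne_zero (sub_ne_zero.2 hc.symm) (Real.rpow_pos_of_pos (abs_pos.2 hx0.ne') _).ne'

/-- The normalising constant of the spectral density of fractional noise. -/
def specC (H : ℝ) : ℝ := 1 / (2 * ∫ ξ, osc H 1 ξ)

lemma specC_pos (h0 : 0 < H) (h1 : H < 1) : 0 < specC H := by
  have := integral_osc_one_pos h0 h1
  unfold specC
  positivity

lemma specC_mul_integral_osc (h0 : 0 < H) (h1 : H < 1) (s : ℝ) :
    specC H * ∫ ξ, osc H s ξ = |s| ^ (2 * H) / 2 := by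
  rw [integral_osc_eq h0, specC]
  have := (integral_osc_one_pos h0 h1).ne'
  field_simp

/-- The spectral density of fractional noise. -/
def specDens (H ξ : ℝ) : NNReal := (specC H * |ξ| ^ (1 - 2 * H)).toNNReal

/-- The spectral measure of fractional noise. -/
def specMeas (H : ℝ) : Measure ℝ := volume.withDensity fun ξ => (specDens H ξ : ENNReal)

instance : SFinite (specMeas H) := by unfold specMeas; infer_instance

lemma measurable_specDens : Measurable (specDens H) := by unfold specDens; fun_prop

lemma coe_specDens (h0 : 0 < H) (h1 : H < 1) (ξ : ℝ) :
    (specDens H ξ : ℝ) = specC H * |ξ| ^ (1 - 2 * H) :=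
  Real.coe_toNNReal _ (mul_nonneg (specC_pos h0 h1).le (by positivity))

lemma integral_specMeas (h0 : 0 < H) (h1 : H < 1) (f : ℝ → ℝ) :
    ∫ ξ, f ξ ∂(specMeas H) = ∫ ξ, specC H * |ξ| ^ (1 - 2 * H) * f ξ := by
  rw [specMeas, integral_withDensity_eq_integral_smul measurable_specDens]
  simp only [NNReal.smul_def, smul_eq_mul, coe_specDens h0 h1]

lemma integrable_specMeas_iff (h0 : 0 < H) (h1 : H < 1) {f : ℝ → ℝ} :
    Integrable f (specMeas H) ↔ Integrable fun ξ => specC H * |ξ| ^ (1 - 2 * H) * f ξ := by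
  rw [specMeas, integrable_withDensity_iff_integrable_smul measurable_specDens]
  simp only [NNReal.smul_def, smul_eq_mul, coe_specDens h0 h1]

lemma specMeas_absolutelyContinuous : specMeas H ≪ volume := withDensity_absolutelyContinuous _ _

lemma ae_specMeas_ne_zero : ∀ᵐ ξ ∂(specMeas H), ξ ≠ 0 :=
  specMeas_absolutelyContinuous.ae_le (compl_mem_ae_iff.2 (measure_singleton (0 : ℝ)))

lemma rpow_abs_eq {ξ : ℝ} (hξ : ξ ≠ 0) :
    |ξ| ^ (1 - 2 * H) = |ξ| ^ (-1 - 2 * H) * ξ ^ 2 := by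
  rw [show 1 - 2 * H = (-1 - 2 * H) + 2 by ring, Real.rpow_add (abs_pos.2 hξ), Real.rpow_two,
    sq_abs]

/-- The kernel `cos + sin` of the Hartley transform. -/
def cas (x : ℝ) : ℝ := Real.cos x + Real.sin x

lemma continuous_cas : Continuous cas := by unfold cas; fun_prop

lemma abs_cas_le (x : ℝ) : |cas x| ≤ 2 := by
  unfold cas
  exact (abs_add_le _ _).trans (by linarith [Real.abs_cos_le_one x, Real.abs_sin_le_one x])

/-- The Hartley transform of the indicator function of `[0, s]`. -/
def feat (s ξ : ℝ) : ℝ := (Real.sin (s * ξ) + 1 - Real.cos (s * ξ)) / ξ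

lemma integral_cas {ξ : ℝ} (hξ : ξ ≠ 0) (s : ℝ) :
    ∫ x in (0 : ℝ)..s, cas (x * ξ) = feat s ξ := by
  unfold cas
  rw [intervalIntegral.integral_add
      (Continuous.intervalIntegrable (by fun_prop) _ _)
      (Continuous.intervalIntegrable (by fun_prop) _ _),
    intervalIntegral.integral_comp_mul_right (fun x => Real.cos x) hξ,
    intervalIntegral.integral_comp_mul_right (fun x => Real.sin x) hξ, integral_cos, integral_sin]
  simp [feat]
  field_simp
  ring

lemma measurable_feat (s : ℝ) : Measurable (feat s) := by unfold feat; fun_prop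

lemma memLp_feat (h0 : 0 < H) (h1 : H < 1) (s : ℝ) : MemLp (feat s) 2 (specMeas H) := by
  rw [memLp_two_iff_integrable_sq (measurable_feat s).aestronglyMeasurable,
    integrable_specMeas_iff h0 h1]
  refine ((integrable_osc h0 h1 s).const_mul (4 * specC H)).mono' ?_ ?_
  · exact ((measurable_const.mul (by fun_prop)).mul
      ((measurable_feat s).pow_const 2)).aestronglyMeasurable
  · filter_upwards [compl_mem_ae_iff.2 (measure_singleton (0 : ℝ))] with ξ hξ
    have hξ' : ξ ≠ 0 := hξ
    have hc := (specC_pos h0 h1).le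
    rw [Real.norm_of_nonneg (by positivity), rpow_abs_eq hξ', feat, osc, div_pow]
    -- The left side equals `2(1 - cos)(1 + sin)`.
    have key : (Real.sin (s * ξ) + 1 - Real.cos (s * ξ)) ^ 2 ≤ 4 * (1 - Real.cos (s * ξ)) := by
      nlinarith [Real.sin_sq_add_cos_sq (s * ξ), Real.sin_le_one (s * ξ), Real.cos_le_one (s * ξ),
        mul_nonneg (sub_nonneg.2 (Real.sin_le_one (s * ξ)))
          (sub_nonneg.2 (Real.cos_le_one (s * ξ)))]
    have hw : 0 ≤ specC H * |ξ| ^ (-1 - 2 * H) := by positivity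
    calc specC H * (|ξ| ^ (-1 - 2 * H) * ξ ^ 2)
          * ((Real.sin (s * ξ) + 1 - Real.cos (s * ξ)) ^ 2 / ξ ^ 2)
        = specC H * |ξ| ^ (-1 - 2 * H) * (Real.sin (s * ξ) + 1 - Real.cos (s * ξ)) ^ 2 := by
          field_simp
      _ ≤ specC H * |ξ| ^ (-1 - 2 * H) * (4 * (1 - Real.cos (s * ξ))) := by gcongr
      _ = _ := by ring

lemma integral_eq_half_integral_add_neg {F : ℝ → ℝ} (hF : Integrable F) :
    ∫ ξ, F ξ = (∫ ξ, (F ξ + F (-ξ))) / 2 := by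
  rw [integral_add hF hF.comp_neg, integral_neg_eq_self]
  ring

/-- The covariance function of two-sided fractional Brownian motion. -/
def covAll (H s t : ℝ) : ℝ := (|s| ^ (2 * H) + |t| ^ (2 * H) - |s - t| ^ (2 * H)) / 2

lemma covAll_eq_cov {s t : ℝ} (hs : 0 ≤ s) (ht : 0 ≤ t) : covAll H s t = cov H s t := by
  rw [covAll, cov, abs_of_nonneg hs, abs_of_nonneg ht]

/-- The density is even, so only the even part of the product counts. Its numerator is `(1 - cos sξ)
+ (1 - cos tξ) - (1 - cos (s-t)ξ)`, and each bracket integrates to a multiple of a power `|·|^(2H)`.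
-/
lemma integral_feat_mul_feat (h0 : 0 < H) (h1 : H < 1) (s t : ℝ) :
    ∫ ξ, feat s ξ * feat t ξ ∂(specMeas H) = covAll H s t := by
  have hi := (memLp_feat h0 h1 s).integrable_mul (memLp_feat h0 h1 t)
  have hi' := (integrable_specMeas_iff h0 h1).1 hi
  rw [integral_specMeas h0 h1]
  refine (integral_eq_half_integral_add_neg hi').trans ?_
  have : ∫ ξ, (specC H * |ξ| ^ (1 - 2 * H) * (feat s * feat t) ξ
      + specC H * |-ξ| ^ (1 - 2 * H) * (feat s * feat t) (-ξ))
      = ∫ ξ, 2 * specC H * (osc H s ξ + osc H t ξ - osc H (s - t) ξ) := by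
    refine integral_congr_ae ?_
    filter_upwards [compl_mem_ae_iff.2 (measure_singleton (0 : ℝ))] with ξ hξ
    have hξ' : ξ ≠ 0 := hξ
    simp only [Pi.mul_apply, feat, osc, abs_neg, mul_neg, Real.sin_neg, Real.cos_neg,
      rpow_abs_eq hξ', sub_mul, Real.cos_sub]
    field_simp
    ring
  rw [this, integral_const_mul, integral_sub
    (f := fun ξ => osc H s ξ + osc H t ξ)
    ((integrable_osc h0 h1 s).add (integrable_osc h0 h1 t)) (integrable_osc h0 h1 _),
    integral_add (integrable_osc h0 h1 s) (integrable_osc h0 h1 t), covAll]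
  linear_combination specC_mul_integral_osc h0 h1 s + specC_mul_integral_osc h0 h1 t
    - specC_mul_integral_osc h0 h1 (s - t)

/-- The transform of `1_[0,s]` as an element of the spectral `L²` space. -/
def featL (h0 : 0 < H) (h1 : H < 1) (s : ℝ) : Lp ℝ 2 (specMeas H) := (memLp_feat h0 h1 s).toLp

lemma inner_featL (h0 : 0 < H) (h1 : H < 1) (s t : ℝ) :
    ⟪featL h0 h1 s, featL h0 h1 t⟫ = covAll H s t := by
  rw [featL, featL, inner_toLp_toLp, integral_feat_mul_feat h0 h1]

/-- `‖x s - x t‖²` is a combination of inner products. Thus the curves of indicators are continuous,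
and Bochner integrable on compact intervals, as soon as their Gram kernels are continuous. -/
lemma continuous_of_continuous_inner {X E : Type*} [TopologicalSpace X] [NormedAddCommGroup E]
    [InnerProductSpace ℝ E] {x : X → E} (h : Continuous fun p : X × X => ⟪x p.1, x p.2⟫) :
    Continuous x := by
  rw [continuous_iff_continuousAt]
  intro t
  rw [ContinuousAt, tendsto_iff_norm_sub_tendsto_zero]
  have h2 : Continuous fun s => ⟪x s, x s⟫ - 2 * ⟪x s, x t⟫ + ⟪x t, x t⟫ :=
    ((h.comp (continuous_id.prodMk continuous_id)).sub
      (continuous_const.mul (h.comp (continuous_id.prodMk continuous_const)))).add continuous_const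
  have h3 : (fun s => ‖x s - x t‖) = fun s => √(⟪x s, x s⟫ - 2 * ⟪x s, x t⟫ + ⟪x t, x t⟫) := by
    funext s
    rw [← Real.sqrt_sq (norm_nonneg (x s - x t)), norm_sub_sq_real, real_inner_self_eq_norm_sq,
      real_inner_self_eq_norm_sq]
  rw [h3]
  have h4 := (Real.continuous_sqrt.comp h2).tendsto t
  simp only [Function.comp_def] at h4
  convert h4 using 2
  rw [eq_comm, Real.sqrt_eq_zero']
  linarith

lemma continuous_featL (h0 : 0 < H) (h1 : H < 1) : Continuous (featL h0 h1) := by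
  refine continuous_of_continuous_inner ?_
  simp only [inner_featL, covAll]
  have hp : 0 ≤ 2 * H := by linarith
  exact (((continuous_fst.abs.rpow_const fun _ => Or.inr hp).add
    (continuous_snd.abs.rpow_const fun _ => Or.inr hp)).sub
    ((continuous_fst.sub continuous_snd).abs.rpow_const fun _ => Or.inr hp)).div_const 2

end Spectral

/-! ### The functions `h_t` as elements of the completion -/

section Elements

/-- Lebesgue measure on `[0, T]`. -/
abbrev volOn (T : ℝ) : Measure ℝ := volume.restrict (Set.Icc 0 T)

lemma ind_eq_ite (s x : ℝ) : ind s x = if 0 ≤ x ∧ x ≤ s then 1 else 0 := by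
  simp [ind, Set.indicator_apply]

lemma abs_ind_le_one (s x : ℝ) : |ind s x| ≤ 1 := by
  rw [ind_eq_ite]
  split_ifs <;> simp

lemma measurable_uncurry_ind : Measurable fun p : ℝ × ℝ => ind p.1 p.2 := by
  simp only [ind_eq_ite]
  exact Measurable.ite ((measurableSet_le measurable_const measurable_snd).inter
    (measurableSet_le measurable_snd measurable_fst)) measurable_const measurable_const

lemma measurable_ind (s : ℝ) : Measurable (ind s) :=
  measurable_uncurry_ind.comp measurable_prodMk_left

lemma memLp_ind (T s : ℝ) : MemLp (ind s) 2 (volOn T) :=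
  MemLp.of_bound (measurable_ind s).aestronglyMeasurable 1
    (Eventually.of_forall fun x => abs_ind_le_one s x)

/-- `1_[0,s]` as an element of `L²([0, T])`. -/
def indL (T s : ℝ) : Lp ℝ 2 (volOn T) := (memLp_ind T s).toLp

lemma inner_indL (T s t : ℝ) : ⟪indL T s, indL T t⟫ = max (min (min s t) T) 0 := by
  rw [indL, indL, inner_toLp_toLp]
  have h : ∀ x, ind s x * ind t x = (Set.Icc 0 (min s t)).indicator (fun _ => (1 : ℝ)) x := by
    intro x
    simp only [ind_eq_ite, Set.indicator_apply, Set.mem_Icc, le_min_iff]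
    split_ifs <;> simp_all
  simp_rw [h]
  rw [integral_indicator measurableSet_Icc, Measure.restrict_restrict measurableSet_Icc,
    Set.Icc_inter_Icc]
  simp

lemma continuous_indL (T : ℝ) : Continuous (indL T) := by
  refine continuous_of_continuous_inner ?_
  simp only [inner_indL]
  fun_prop

lemma memLp_cas (T ξ : ℝ) : MemLp (fun x => cas (x * ξ)) 2 (volOn T) :=
  MemLp.of_bound (continuous_cas.comp (by fun_prop)).aestronglyMeasurable 2
    (Eventually.of_forall fun x => abs_cas_le _)

/-- The kernel of the Hartley transform as an element of `L²([0, T])`. -/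
def casL (T ξ : ℝ) : Lp ℝ 2 (volOn T) := (memLp_cas T ξ).toLp

lemma memLp_ind_Icc (T : ℝ) (s : Set.Icc (0 : ℝ) T) :
    MemLp (fun x => ind s x) 2 (volOn T) := memLp_ind T s

variable {H : ℝ} (h0 : 0 < H) (h1 : H < 1)

/-- The kernel hypothesis needed for closability. The point `ξ = 0` is excluded because there `feat
s` takes the default value `0` of division by zero instead of `s`. -/
lemma featL_ae (T : ℝ) (s : Set.Icc (0 : ℝ) T) :
    featL h0 h1 s =ᵐ[specMeas H]
      fun ξ => ⟪casL T ξ, (memLp_ind_Icc T s).toLp (fun x => ind s x)⟫ := by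
  filter_upwards [(memLp_feat h0 h1 s).coeFn_toLp, ae_specMeas_ne_zero] with ξ h hξ
  rw [featL, h, casL, inner_toLp_toLp, ← integral_cas hξ, intervalIntegral.integral_of_le s.2.1,
    ← integral_Icc_eq_integral_Ioc]
  have h2 : ∀ x, cas (x * ξ) * ind s x
      = (Set.Icc 0 (s : ℝ)).indicator (fun x => cas (x * ξ)) x := by
    intro x
    simp only [ind, Set.indicator_apply]
    split_ifs <;> simp
  simp_rw [h2]
  rw [integral_indicator measurableSet_Icc, Measure.restrict_restrict measurableSet_Icc,
    Set.inter_eq_self_of_subset_left (Set.Icc_subset_Icc_right s.2.2)]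

/-- The closed graph of the transform on `[0, T]`. -/
def graphOne (T : ℝ) : Submodule ℝ (Lp ℝ 2 (volOn T) × Lp ℝ 2 (specMeas H)) :=
  closedGraph (memLp_ind_Icc T) fun s => featL h0 h1 s

/-- The graph element belonging to `1_[0,s]`. -/
def indVec (T s : ℝ) : Lp ℝ 2 (volOn T) × Lp ℝ 2 (specMeas H) := (indL T s, featL h0 h1 s)

lemma continuous_indVec (T : ℝ) : Continuous (indVec h0 h1 T) :=
  (continuous_indL T).prodMk (continuous_featL h0 h1)

lemma indVec_mem {T s : ℝ} (hs : s ∈ Set.Icc 0 T) : indVec h0 h1 T s ∈ graphOne h0 h1 T :=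
  graphVec_mem_closedGraph (he := memLp_ind_Icc T) (d := fun s => featL h0 h1 s) ⟨s, hs⟩

/-- Exponential smoothing `x t - ∫₀ᵗ e^{s-t} x s ds` of a curve. -/
def expSmooth {E : Type*} [NormedAddCommGroup E] [NormedSpace ℝ E] (x : ℝ → E) (t : ℝ) : E :=
  x t - ∫ s in (0 : ℝ)..t, Real.exp (s - t) • x s

lemma continuous_expSmooth {E : Type*} [NormedAddCommGroup E] [NormedSpace ℝ E]
    {x : ℝ → E} (hx : Continuous x) : Continuous (expSmooth x) := by
  refine hx.sub ?_
  -- With `e^(-t)` taken out, `t` remains only as an endpoint of integration.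
  have h : (fun t => ∫ s in (0 : ℝ)..t, Real.exp (s - t) • x s)
      = fun t => Real.exp (-t) • ∫ s in (0 : ℝ)..t, Real.exp s • x s := by
    funext t
    rw [← intervalIntegral.integral_smul]
    refine intervalIntegral.integral_congr fun s _ => ?_
    simp only [smul_smul, ← Real.exp_add]
    ring_nf
  rw [h]
  refine (by fun_prop : Continuous fun t : ℝ => Real.exp (-t)).smul ?_
  have hc : Continuous fun s => Real.exp s • x s := Real.continuous_exp.smul hx
  exact intervalIntegral.continuous_primitive (fun a b => hc.intervalIntegrable a b) 0

lemma map_expSmooth {E F : Type*} [NormedAddCommGroup E] [NormedSpace ℝ E] [CompleteSpace E]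
    [NormedAddCommGroup F] [NormedSpace ℝ F] [CompleteSpace F] (L : E →L[ℝ] F) {x : ℝ → E}
    (hx : Continuous x) (t : ℝ) : L (expSmooth x t) = expSmooth (fun s => L (x s)) t := by
  have hc : Continuous fun s => Real.exp (s - t) • x s :=
    (by fun_prop : Continuous fun s : ℝ => Real.exp (s - t)).smul hx
  simp only [expSmooth, map_sub]
  rw [← L.intervalIntegral_comp_comm (hc.intervalIntegrable 0 t)]
  simp only [map_smul]

/-- The transform of `h_t`. -/
def hFeat (t : ℝ) : Lp ℝ 2 (specMeas H) := expSmooth (featL h0 h1) t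

lemma continuous_hFeat : Continuous (hFeat h0 h1) := continuous_expSmooth (continuous_featL h0 h1)

lemma expSmooth_indVec (T t : ℝ) :
    expSmooth (indVec h0 h1 T) t = (expSmooth (indL T) t, hFeat h0 h1 t) :=
  Prod.ext (map_expSmooth (ContinuousLinearMap.fst ℝ _ _) (continuous_indVec h0 h1 T) t)
    (map_expSmooth (ContinuousLinearMap.snd ℝ _ _) (continuous_indVec h0 h1 T) t)

lemma expSmooth_indVec_mem {T t : ℝ} (ht : t ∈ Set.Icc 0 T) :
    expSmooth (indVec h0 h1 T) t ∈ graphOne h0 h1 T := by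
  refine Submodule.sub_mem _ (indVec_mem h0 h1 ht) ?_
  rw [intervalIntegral.integral_of_le ht.1]
  refine integral_mem_of_isClosed (Submodule.isClosed_topologicalClosure _) ?_
  filter_upwards [ae_restrict_mem measurableSet_Ioc] with s hs
  exact Submodule.smul_mem _ _ (indVec_mem h0 h1 ⟨hs.1.le, hs.2.trans ht.2⟩)

lemma hT_eq_ite (t x : ℝ) : hT t x = if 0 ≤ x ∧ x ≤ t then Real.exp (x - t) else 0 := by
  simp [hT, Set.indicator_apply]

lemma abs_hT_le_one (t x : ℝ) : |hT t x| ≤ 1 := by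
  rw [hT_eq_ite]
  split_ifs with h
  · rw [abs_of_pos (Real.exp_pos _)]
    exact Real.exp_le_one_iff.2 (by linarith [h.2])
  · simp

lemma measurable_uncurry_hT : Measurable fun p : ℝ × ℝ => hT p.1 p.2 := by
  simp only [hT_eq_ite]
  exact Measurable.ite ((measurableSet_le measurable_const measurable_snd).inter
    (measurableSet_le measurable_snd measurable_fst)) (by fun_prop) measurable_const

lemma measurable_hT (t : ℝ) : Measurable (hT t) :=
  measurable_uncurry_hT.comp measurable_prodMk_left

lemma memLp_hT (T t : ℝ) : MemLp (hT t) 2 (volOn T) :=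
  MemLp.of_bound (measurable_hT t).aestronglyMeasurable 1
    (Eventually.of_forall fun x => abs_hT_le_one t x)

lemma setIntegral_exp_mul_ind {x t : ℝ} (hx : 0 ≤ x) :
    ∫ s in Set.Ioc 0 t, Real.exp (s - t) * ind s x = if x ≤ t then 1 - Real.exp (x - t) else 0 := by
  have h : ∀ᵐ s ∂volume.restrict (Set.Ioc 0 t), Real.exp (s - t) * ind s x
      = (Set.Ioi x).indicator (fun s => Real.exp (s - t)) s := by
    refine ae_restrict_of_ae ?_
    filter_upwards [compl_mem_ae_iff.2 (measure_singleton x)] with s hs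
    have hs' : s ≠ x := hs
    simp only [ind_eq_ite, Set.indicator_apply, Set.mem_Ioi, hx, true_and,
      le_iff_lt_or_eq, hs'.symm, or_false]
    split_ifs <;> simp
  rw [integral_congr_ae h, integral_indicator measurableSet_Ioi,
    Measure.restrict_restrict measurableSet_Ioi, Set.inter_comm, Set.Ioc_inter_Ioi,
    max_eq_right hx]
  split_ifs with hxt
  · rw [← intervalIntegral.integral_of_le hxt,
      intervalIntegral.integral_comp_sub_right (fun s => Real.exp s), integral_exp]
    simp
  · rw [Set.Ioc_eq_empty (by linarith)]
    simp

/-- On `[0,t]` one has `h_t(u) = 1 - ∫_u^t e^(s-t) ds`, so `h_t` is a superposition of generators;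
this places it in the closed graph. -/
lemma expSmooth_indL {T t : ℝ} (ht : 0 ≤ t) : expSmooth (indL T) t = (memLp_hT T t).toLp := by
  refine Lp.ext ?_
  have hc : Continuous fun s => Real.exp (s - t) • indL T s :=
    (by fun_prop : Continuous fun s : ℝ => Real.exp (s - t)).smul (continuous_indL T)
  have hI := coeFn_integral_ae (τ := volume.restrict (Set.Ioc 0 t)) (μ := volOn T)
    (F := fun s => Real.exp (s - t) • indL T s) (f := fun s x => Real.exp (s - t) * ind s x)
    ((hc.integrableOn_Icc (a := 0) (b := t)).mono_set Set.Ioc_subset_Icc_self) ?_ ?_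
  · have e1 : expSmooth (indL T) t
        = indL T t - ∫ s in Set.Ioc 0 t, Real.exp (s - t) • indL T s := by
      rw [expSmooth, intervalIntegral.integral_of_le ht]
    rw [e1]
    filter_upwards [hI, Lp.coeFn_sub (indL T t) (∫ s in Set.Ioc 0 t, Real.exp (s - t) • indL T s),
      (memLp_ind T t).coeFn_toLp, (memLp_hT T t).coeFn_toLp, ae_restrict_mem measurableSet_Icc]
      with x hx1 hx2 hx3 hx4 hx5
    rw [hx2, Pi.sub_apply, hx1, hx4, indL, hx3, setIntegral_exp_mul_ind hx5.1, ind_eq_ite,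
      hT_eq_ite]
    have := hx5.1
    split_ifs <;> simp_all
  · refine Integrable.of_bound (C := 1) ?_ ?_
    · exact ((by fun_prop : Measurable fun p : ℝ × ℝ => Real.exp (p.1 - t)).mul
        measurable_uncurry_ind).aestronglyMeasurable
    · have : ∀ᵐ s ∂volume.restrict (Set.Ioc 0 t), s ≤ t := by
        filter_upwards [ae_restrict_mem measurableSet_Ioc] with s hs using hs.2
      filter_upwards [Measure.quasiMeasurePreserving_fst.ae this] with p hp
      simp only [Function.uncurry, Real.norm_eq_abs, abs_mul, Real.abs_exp]
      exact mul_le_one₀ (Real.exp_le_one_iff.2 (by linarith)) (abs_nonneg _) (abs_ind_le_one _ _)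
  · refine Eventually.of_forall fun s => ?_
    filter_upwards [Lp.coeFn_smul (Real.exp (s - t)) (indL T s), (memLp_ind T s).coeFn_toLp]
      with x hx1 hx2
    rw [hx1, Pi.smul_apply, indL, hx2, smul_eq_mul]

lemma hFeat_mem {T t : ℝ} (ht : t ∈ Set.Icc 0 T) :
    ((memLp_hT T t).toLp, hFeat h0 h1 t) ∈ graphOne h0 h1 T := by
  rw [← expSmooth_indL ht.1, ← expSmooth_indVec h0 h1]
  exact expSmooth_indVec_mem h0 h1 ht

/-- The covariance function of the fractional Ornstein-Uhlenbeck process started at `0`. -/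
def covOU (s t : ℝ) : ℝ := ⟪hFeat h0 h1 s, hFeat h0 h1 t⟫

lemma continuous_covOU : Continuous fun p : ℝ × ℝ => covOU h0 h1 p.1 p.2 :=
  ((continuous_hFeat h0 h1).comp continuous_fst).inner ((continuous_hFeat h0 h1).comp continuous_snd)

lemma inner_featL_Icc (T : ℝ) (s t : Set.Icc (0 : ℝ) T) :
    ⟪featL h0 h1 s, featL h0 h1 t⟫ = cov H s t := by
  rw [inner_featL, covAll_eq_cov s.2.1 t.2.1]

theorem isNormSqOne_hT_iff {T t : ℝ} (ht : t ∈ Set.Icc 0 T) (N : ℝ) :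
    IsNormSqOne H T (hT t) N ↔ N = covOU h0 h1 t t := by
  rw [covOU, real_inner_self_eq_norm_sq]
  exact isNormSq_iff (inner_featL_Icc h0 h1 T) (featL_ae h0 h1 T) (memLp_hT T t)
    (hFeat_mem h0 h1 ht) N

lemma hFeat_ae {t : ℝ} (ht : 0 ≤ t) :
    hFeat h0 h1 t =ᵐ[specMeas H] fun ξ => ∫ x in (0 : ℝ)..t, Real.exp (x - t) * cas (x * ξ) := by
  -- `hFeat` does not depend on the horizon, which may therefore be taken to be `t` itself.
  have h := snd_ae_of_mem_closedGraph (featL_ae h0 h1 t)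
    (hFeat_mem h0 h1 (Set.right_mem_Icc.2 ht))
  filter_upwards [h] with ξ hξ
  rw [hξ, casL, inner_toLp_toLp, intervalIntegral.integral_of_le ht,
    ← integral_Icc_eq_integral_Ioc]
  refine setIntegral_congr_fun measurableSet_Icc fun x hx => ?_
  simp only [hT_eq_ite, if_pos (Set.mem_Icc.1 hx), mul_comm]

end Elements

/-! ### The function `f_T` in the tensor square -/

section Square

variable {H : ℝ} (h0 : 0 < H) (h1 : H < 1)

lemma abs_fT_le_one (T : ℝ) (p : ℝ × ℝ) : |fT T p| ≤ 1 := by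
  unfold fT
  rw [Set.indicator_apply]
  split_ifs
  · rw [Real.abs_exp]
    exact Real.exp_le_one_iff.2 (neg_nonpos.2 (abs_nonneg _))
  · simp

lemma measurable_fT (T : ℝ) : Measurable (fT T) :=
  Measurable.indicator (by fun_prop) (measurableSet_Icc.prod measurableSet_Icc)

lemma memLp_fT (T : ℝ) : MemLp (fT T) 2 ((volOn T).prod (volOn T)) :=
  MemLp.of_bound (measurable_fT T).aestronglyMeasurable 1
    (Eventually.of_forall fun x => abs_fT_le_one T x)

/-- The integrand is `e^(x+y-2t)` for `t ≥ max x y` and `0` before. Solved for `e^(-|x-y|)`, the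
formula is the decomposition of `f_T` used in `fVec`. -/
lemma setIntegral_hT_mul_hT {x y T : ℝ} (hx : x ∈ Set.Icc 0 T) (hy : y ∈ Set.Icc 0 T) :
    ∫ t in Set.Ioc 0 T, hT t x * hT t y
      = (Real.exp (-|x - y|) - Real.exp (x - T) * Real.exp (y - T)) / 2 := by
  have hm : 0 ≤ max x y := hx.1.trans (le_max_left _ _)
  have hmT : max x y ≤ T := max_le hx.2 hy.2
  have h : ∀ᵐ t ∂volume.restrict (Set.Ioc 0 T), hT t x * hT t y
      = (Set.Ioi (max x y)).indicator (fun t => Real.exp (x + y) * Real.exp (-2 * t)) t := by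
    refine ae_restrict_of_ae ?_
    filter_upwards [compl_mem_ae_iff.2 (measure_singleton x),
      compl_mem_ae_iff.2 (measure_singleton y)] with t ht1 ht2
    have ht1' : t ≠ x := ht1
    have ht2' : t ≠ y := ht2
    simp only [hT_eq_ite, Set.indicator_apply, Set.mem_Ioi, hx.1, hy.1, true_and, max_lt_iff,
      le_iff_lt_or_eq, ht1'.symm, ht2'.symm, or_false]
    by_cases c1 : x < t <;> by_cases c2 : y < t <;> simp [c1, c2]
    rw [← Real.exp_add, ← Real.exp_add]
    ring_nf
  rw [integral_congr_ae h, integral_indicator measurableSet_Ioi,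
    Measure.restrict_restrict measurableSet_Ioi, Set.inter_comm, Set.Ioc_inter_Ioi,
    max_eq_right hm, ← intervalIntegral.integral_of_le hmT, intervalIntegral.integral_const_mul,
    intervalIntegral.integral_comp_mul_left (fun t => Real.exp t) (by norm_num), integral_exp,
    smul_eq_mul, ← Real.exp_add]
  have e1 : Real.exp (-|x - y|) = Real.exp (x + y) * Real.exp (-2 * max x y) := by
    rw [← Real.exp_add]
    congr 1
    rcases le_total x y with h | h
    · rw [max_eq_right h, abs_of_nonpos (by linarith)]; ring
    · rw [max_eq_left h, abs_of_nonneg (by linarith)]; ring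
  have e2 : Real.exp (x - T + (y - T)) = Real.exp (x + y) * Real.exp (-2 * T) := by
    rw [← Real.exp_add]
    ring_nf
  rw [e1, e2]
  ring

/-- `1_[0,s] ⊗ 1_[0,t]` is square-integrable on `[0, T]²`. -/
lemma memLp_ind_prod (T : ℝ) (p : Set.Icc (0 : ℝ) T × Set.Icc (0 : ℝ) T) :
    MemLp (fun x : ℝ × ℝ => ind p.1 x.1 * ind p.2 x.2) 2 ((volOn T).prod (volOn T)) :=
  memLp_prodMul (memLp_ind_Icc T p.1) (memLp_ind_Icc T p.2)

/-- The closed graph of the transform on `[0, T]²`. -/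
def graphTwo (T : ℝ) : Submodule ℝ
    (Lp ℝ 2 ((volOn T).prod (volOn T)) × Lp ℝ 2 ((specMeas H).prod (specMeas H))) :=
  closedGraph (memLp_ind_prod T)
    fun p => tensorL (specMeas H) (specMeas H) (featL h0 h1 p.1) (featL h0 h1 p.2)

/-- The tensor square of a pair. -/
def sqVec {T : ℝ} (x : Lp ℝ 2 (volOn T) × Lp ℝ 2 (specMeas H)) :
    Lp ℝ 2 ((volOn T).prod (volOn T)) × Lp ℝ 2 ((specMeas H).prod (specMeas H)) :=
  (tensorL _ _ x.1 x.1, tensorL _ _ x.2 x.2)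

lemma continuous_sqVec {T : ℝ} : Continuous (sqVec (H := H) (T := T)) :=
  ((((tensorL _ _).continuous.comp continuous_fst).clm_apply continuous_fst)).prodMk
    ((((tensorL _ _).continuous.comp continuous_snd).clm_apply continuous_snd))

lemma sqVec_mem {T : ℝ} {x : Lp ℝ 2 (volOn T) × Lp ℝ 2 (specMeas H)}
    (hx : x ∈ graphOne h0 h1 T) : sqVec x ∈ graphTwo h0 h1 T := by
  have h := tensorL_mem_closedGraph (he := memLp_ind_Icc T) (he' := memLp_ind_Icc T)
    (d := fun s : Set.Icc (0 : ℝ) T => featL h0 h1 s)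
    (d' := fun s : Set.Icc (0 : ℝ) T => featL h0 h1 s) hx hx
  exact h

/-- The pair of `f_T` and its transform. -/
def fVec (T : ℝ) :
    Lp ℝ 2 ((volOn T).prod (volOn T)) × Lp ℝ 2 ((specMeas H).prod (specMeas H)) :=
  sqVec (expSmooth (indVec h0 h1 T) T)
    + (2 : ℝ) • ∫ t in (0 : ℝ)..T, sqVec (expSmooth (indVec h0 h1 T) t)

lemma continuous_sqVec_expSmooth (T : ℝ) :
    Continuous fun t => sqVec (expSmooth (indVec h0 h1 T) t) :=
  continuous_sqVec.comp (continuous_expSmooth (continuous_indVec h0 h1 T))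

lemma fVec_mem {T : ℝ} (hT : 0 ≤ T) : fVec h0 h1 T ∈ graphTwo h0 h1 T := by
  refine Submodule.add_mem _
    (sqVec_mem h0 h1 (expSmooth_indVec_mem h0 h1 (Set.right_mem_Icc.2 hT)))
    (Submodule.smul_mem _ _ ?_)
  rw [intervalIntegral.integral_of_le hT]
  refine integral_mem_of_isClosed (Submodule.isClosed_topologicalClosure _) ?_
  filter_upwards [ae_restrict_mem measurableSet_Ioc] with s hs
  exact sqVec_mem h0 h1 (expSmooth_indVec_mem h0 h1 ⟨hs.1.le, hs.2⟩)

lemma sqVec_expSmooth_fst_ae {T t : ℝ} (ht : 0 ≤ t) :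
    (sqVec (expSmooth (indVec h0 h1 T) t)).1 =ᵐ[(volOn T).prod (volOn T)]
      fun z => hT t z.1 * hT t z.2 := by
  rw [sqVec, expSmooth_indVec, expSmooth_indL ht]
  exact (coeFn_tensorL _ _).trans
    (prodMul_congr_ae (memLp_hT T t).coeFn_toLp (memLp_hT T t).coeFn_toLp)

lemma fVec_fst {T : ℝ} (hT0 : 0 ≤ T) : (fVec h0 h1 T).1 = (memLp_fT T).toLp := by
  have hc := continuous_sqVec_expSmooth h0 h1 T
  have hfst : (fVec h0 h1 T).1 = (sqVec (expSmooth (indVec h0 h1 T) T)).1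
      + (2 : ℝ) • ∫ t in Set.Ioc 0 T, (sqVec (expSmooth (indVec h0 h1 T) t)).1 := by
    rw [← intervalIntegral.integral_of_le hT0]
    have := (ContinuousLinearMap.fst ℝ (Lp ℝ 2 ((volOn T).prod (volOn T)))
      (Lp ℝ 2 ((specMeas H).prod (specMeas H)))).intervalIntegral_comp_comm
      (hc.intervalIntegrable (μ := volume) 0 T)
    simp only [ContinuousLinearMap.coe_fst'] at this
    rw [this]
    rfl
  have hI := coeFn_integral_ae (τ := volume.restrict (Set.Ioc 0 T))
    (μ := (volOn T).prod (volOn T))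
    (F := fun t => (sqVec (expSmooth (indVec h0 h1 T) t)).1)
    (f := fun t z => hT t z.1 * hT t z.2)
    ((hc.fst.integrableOn_Icc (a := 0) (b := T)).mono_set Set.Ioc_subset_Icc_self) ?_ ?_
  · rw [hfst]
    refine Lp.ext ?_
    have hmem : ∀ᵐ z ∂((volOn T).prod (volOn T)), z ∈ Set.Icc (0 : ℝ) T ×ˢ Set.Icc (0 : ℝ) T := by
      rw [Measure.prod_restrict]
      exact ae_restrict_mem (measurableSet_Icc.prod measurableSet_Icc)
    filter_upwards [Lp.coeFn_add (sqVec (expSmooth (indVec h0 h1 T) T)).1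
        ((2 : ℝ) • ∫ t in Set.Ioc 0 T, (sqVec (expSmooth (indVec h0 h1 T) t)).1),
      Lp.coeFn_smul (2 : ℝ) (∫ t in Set.Ioc 0 T, (sqVec (expSmooth (indVec h0 h1 T) t)).1), hI,
      sqVec_expSmooth_fst_ae h0 h1 hT0, (memLp_fT T).coeFn_toLp, hmem] with z a1 a2 a3 a4 a5 a6
    rw [a1, Pi.add_apply, a2, Pi.smul_apply, a3, a4, a5, setIntegral_hT_mul_hT a6.1 a6.2, fT,
      Set.indicator_of_mem a6, hT_eq_ite, hT_eq_ite, if_pos (Set.mem_Icc.1 a6.1),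
      if_pos (Set.mem_Icc.1 a6.2), smul_eq_mul]
    ring
  · refine Integrable.of_bound (C := 1) ?_ (Eventually.of_forall fun p => ?_)
    · exact ((measurable_uncurry_hT.comp (measurable_fst.prodMk measurable_snd.fst)).mul
        (measurable_uncurry_hT.comp
          (measurable_fst.prodMk measurable_snd.snd))).aestronglyMeasurable
    · simp only [Function.uncurry, Real.norm_eq_abs, abs_mul]
      exact mul_le_one₀ (abs_hT_le_one _ _) (abs_nonneg _) (abs_hT_le_one _ _)
  · filter_upwards [ae_restrict_mem measurableSet_Ioc] with t ht
    exact sqVec_expSmooth_fst_ae h0 h1 ht.1.le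

/-- The squared norm of `f_T`, in terms of the covariance of the Ornstein-Uhlenbeck process. -/
def sqNormF (T : ℝ) : ℝ :=
  covOU h0 h1 T T ^ 2 + 4 * (∫ t in (0 : ℝ)..T, covOU h0 h1 T t ^ 2)
    + 4 * ∫ s in (0 : ℝ)..T, ∫ t in (0 : ℝ)..T, covOU h0 h1 s t ^ 2

lemma norm_sq_fVec_snd (T : ℝ) : ‖(fVec h0 h1 T).2‖ ^ 2 = sqNormF h0 h1 T := by
  set B : ℝ → Lp ℝ 2 ((specMeas H).prod (specMeas H)) :=
    fun t => tensorL _ _ (hFeat h0 h1 t) (hFeat h0 h1 t) with hB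
  have hc := continuous_sqVec_expSmooth h0 h1 T
  have hBc : Continuous B := by
    have := hc.snd
    simpa only [sqVec, expSmooth_indVec] using this
  have hsnd : (fVec h0 h1 T).2 = B T + (2 : ℝ) • ∫ t in (0 : ℝ)..T, B t := by
    have := (ContinuousLinearMap.snd ℝ (Lp ℝ 2 ((volOn T).prod (volOn T)))
      (Lp ℝ 2 ((specMeas H).prod (specMeas H)))).intervalIntegral_comp_comm
      (hc.intervalIntegrable (μ := volume) 0 T)
    simp only [ContinuousLinearMap.coe_snd', sqVec, expSmooth_indVec] at this
    simp only [fVec, sqVec, expSmooth_indVec, Prod.snd_add, Prod.smul_snd, hB]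
    rw [this]
  -- Inner products of tensor squares are squares of inner products, so expanding `‖B T + 2 ∫ B‖²`
  -- produces the three terms of `sqNormF`.
  have hin : ∀ s t, ⟪B s, B t⟫ = covOU h0 h1 s t ^ 2 := fun s t => by
    rw [hB, inner_tensorL, covOU, sq]
  have hint : ∀ x : Lp ℝ 2 ((specMeas H).prod (specMeas H)),
      ⟪x, ∫ t in (0 : ℝ)..T, B t⟫ = ∫ t in (0 : ℝ)..T, ⟪x, B t⟫ := fun x =>
    ((innerSL ℝ x).intervalIntegral_comp_comm (hBc.intervalIntegrable 0 T)).symm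
  have hint' : ⟪∫ t in (0 : ℝ)..T, B t, ∫ t in (0 : ℝ)..T, B t⟫
      = ∫ s in (0 : ℝ)..T, ∫ t in (0 : ℝ)..T, ⟪B s, B t⟫ := by
    rw [hint]
    refine intervalIntegral.integral_congr fun s _ => ?_
    rw [real_inner_comm]
    exact hint (B s)
  rw [hsnd, norm_add_sq_real, norm_smul, mul_pow, ← real_inner_self_eq_norm_sq,
    ← real_inner_self_eq_norm_sq (∫ t in (0 : ℝ)..T, B t), real_inner_smul_right, hint', hint]
  simp only [hin, sqNormF]
  norm_num
  ring

theorem isNormSqTwo_fT_iff {T : ℝ} (hT0 : 0 ≤ T) (N : ℝ) :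
    IsNormSqTwo H T (fT T) N ↔ N = sqNormF h0 h1 T := by
  rw [IsNormSqTwo, Measure.volume_eq_prod, ← Measure.prod_restrict, ← norm_sq_fVec_snd]
  refine isNormSq_iff (he := memLp_ind_prod T)
    (d := fun p => tensorL (specMeas H) (specMeas H) (featL h0 h1 p.1) (featL h0 h1 p.2))
    (k := fun z => tensorL _ _ (casL T z.1) (casL T z.2)) (fun p q => ?_) (fun p => ?_)
    (memLp_fT T) ?_ N
  · rw [inner_tensorL, inner_featL_Icc, inner_featL_Icc]
  · refine (coeFn_tensorL _ _).trans
      ((prodMul_congr_ae (featL_ae h0 h1 T p.1) (featL_ae h0 h1 T p.2)).trans ?_)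
    refine Eventually.of_forall fun z => ?_
    have := tensorL_toLp (memLp_ind_Icc T p.1) (memLp_ind_Icc T p.2)
    simp only
    rw [← inner_tensorL, this]
  · have h := fVec_mem h0 h1 hT0
    rw [← Prod.mk.eta (p := fVec h0 h1 T), fVec_fst h0 h1 hT0] at h
    exact h

end Square

/-! ### A Beta integral -/

section GammaIntegral

/-- The kernel comes from writing `Γ(b) (1+x²)^(-b)` as a Gamma integral in `t`. Integrating in `x`
first leaves `e^(-t) t^(b-a/2-1)`, which converges at `0` because `a/2 < b`; by positivity this also
proves joint integrability. -/
lemma integrable_gamma_kernel {a b : ℝ} (ha : 0 < a) (hab : a / 2 < b) :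
    Integrable (Function.uncurry fun x t : ℝ =>
      x ^ (a - 1) * (t ^ (b - 1) * Real.exp (-((1 + x ^ 2) * t))))
      ((volume.restrict (Set.Ioi 0)).prod (volume.restrict (Set.Ioi 0))) ∧
    ∫ t in Set.Ioi 0, ∫ x in Set.Ioi 0,
        x ^ (a - 1) * (t ^ (b - 1) * Real.exp (-((1 + x ^ 2) * t)))
      = Real.Gamma (a / 2) * Real.Gamma (b - a / 2) / 2 := by
  have hpt : ∀ t x : ℝ, x ^ (a - 1) * (t ^ (b - 1) * Real.exp (-((1 + x ^ 2) * t)))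
      = (t ^ (b - 1) * Real.exp (-t)) * (x ^ (a - 1) * Real.exp (-t * x ^ (2 : ℝ))) := by
    intro t x
    rw [Real.rpow_two, show -((1 + x ^ 2) * t) = -t + -t * x ^ 2 by ring, Real.exp_add]
    ring
  have hin : ∀ t ∈ Set.Ioi (0 : ℝ), ∫ x in Set.Ioi 0,
      x ^ (a - 1) * (t ^ (b - 1) * Real.exp (-((1 + x ^ 2) * t)))
      = Real.Gamma (a / 2) / 2 * (Real.exp (-t) * t ^ (b - a / 2 - 1)) := by
    intro t ht
    have ht : 0 < t := ht
    simp_rw [hpt t]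
    rw [integral_const_mul, integral_rpow_mul_exp_neg_mul_rpow two_pos (by linarith) ht,
      show b - a / 2 - 1 = (b - 1) + -(a - 1 + 1) / 2 by ring, Real.rpow_add ht,
      show (a - 1 + 1) / 2 = a / 2 by ring]
    ring
  have hm : Measurable (Function.uncurry fun x t : ℝ =>
      x ^ (a - 1) * (t ^ (b - 1) * Real.exp (-((1 + x ^ 2) * t)))) := by
    unfold Function.uncurry
    fun_prop
  refine ⟨(integrable_prod_iff' hm.aestronglyMeasurable).2 ⟨?_, ?_⟩, ?_⟩
  · filter_upwards [ae_restrict_mem measurableSet_Ioi] with t ht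
    simp only [Function.uncurry_apply_pair, hpt t]
    exact (integrableOn_rpow_mul_exp_neg_mul_rpow (by linarith) two_pos ht).const_mul _
  · have hi : IntegrableOn (fun t => Real.Gamma (a / 2) / 2 *
        (Real.exp (-t) * t ^ (b - a / 2 - 1))) (Set.Ioi 0) :=
      (Real.GammaIntegral_convergent (by linarith)).const_mul _
    refine hi.congr_fun (fun t ht => ?_) measurableSet_Ioi
    simp only
    rw [← hin t ht]
    refine setIntegral_congr_fun measurableSet_Ioi fun x hx => ?_
    have hx : 0 < x := hx
    have ht : 0 < t := ht
    simp only [Function.uncurry_apply_pair]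
    rw [Real.norm_of_nonneg (by positivity)]
  · rw [setIntegral_congr_fun measurableSet_Ioi hin, integral_const_mul,
      ← Real.Gamma_eq_integral (by linarith)]
    ring

lemma gamma_kernel_inner {a b : ℝ} (hb : 0 < b) (x : ℝ) :
    ∫ t in Set.Ioi 0, x ^ (a - 1) * (t ^ (b - 1) * Real.exp (-((1 + x ^ 2) * t)))
      = Real.Gamma b * (x ^ (a - 1) * (1 / (1 + x ^ 2)) ^ b) := by
  rw [integral_const_mul, Real.integral_rpow_mul_exp_neg_mul_Ioi hb (by positivity)]
  ring

lemma integrableOn_rpow_mul_one_add_sq {a b : ℝ} (ha : 0 < a) (hab : a / 2 < b) :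
    IntegrableOn (fun x : ℝ => x ^ (a - 1) * (1 / (1 + x ^ 2)) ^ b) (Set.Ioi 0) := by
  have hb : 0 < b := by linarith
  have h := (integrable_gamma_kernel ha hab).1.integral_prod_left
  simp only [Function.uncurry_apply_pair, gamma_kernel_inner hb] at h
  have hΓ := (Real.Gamma_pos_of_pos hb).ne'
  refine (h.const_mul (Real.Gamma b)⁻¹).congr (Eventually.of_forall fun x => ?_)
  simp only
  rw [inv_mul_cancel_left₀ hΓ]

lemma integral_rpow_mul_one_add_sq {a b : ℝ} (ha : 0 < a) (hab : a / 2 < b) :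
    ∫ x in Set.Ioi 0, x ^ (a - 1) * (1 / (1 + x ^ 2)) ^ b
      = Real.Gamma (a / 2) * Real.Gamma (b - a / 2) / (2 * Real.Gamma b) := by
  have hb : 0 < b := by linarith
  obtain ⟨h1, h2⟩ := integrable_gamma_kernel ha hab
  rw [← integral_integral_swap h1] at h2
  simp only [gamma_kernel_inner hb] at h2
  rw [integral_const_mul] at h2
  have hΓ := (Real.Gamma_pos_of_pos hb).ne'
  rw [eq_div_iff (by positivity)]
  linear_combination 2 * h2

end GammaIntegral

/-! ### The stationary covariance and its spectral density -/

section OU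

/-- The spectral density of the stationary fractional Ornstein-Uhlenbeck process. -/
def ouDens (H ξ : ℝ) : ℝ := specC H * |ξ| ^ (1 - 2 * H) * (1 / (1 + ξ ^ 2))

/-- The covariance function of the stationary fractional Ornstein-Uhlenbeck process. -/
def ouCov (H u : ℝ) : ℝ := ∫ ξ, Real.cos (u * ξ) * ouDens H ξ

variable {H : ℝ}

lemma measurable_ouDens : Measurable (ouDens H) := by unfold ouDens; fun_prop

lemma ouDens_nonneg (h0 : 0 < H) (h1 : H < 1) (ξ : ℝ) : 0 ≤ ouDens H ξ := by
  have := specC_pos h0 h1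
  unfold ouDens
  positivity

lemma ouDens_neg (ξ : ℝ) : ouDens H (-ξ) = ouDens H ξ := by simp [ouDens]

lemma ouDens_eq (ξ : ℝ) : ouDens H ξ
    = specC H * (|ξ| ^ (2 - 2 * H - 1) * (1 / (1 + |ξ| ^ 2)) ^ (1 : ℝ)) := by
  rw [ouDens, Real.rpow_one, sq_abs, show 2 - 2 * H - 1 = 1 - 2 * H by ring, mul_assoc]

lemma ouDens_sq_eq (ξ : ℝ) : ouDens H ξ ^ 2
    = specC H ^ 2 * (|ξ| ^ (3 - 4 * H - 1) * (1 / (1 + |ξ| ^ 2)) ^ (2 : ℝ)) := by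
  rw [ouDens, Real.rpow_two, sq_abs, show 3 - 4 * H - 1 = (1 - 2 * H) * (2 : ℕ) by push_cast; ring,
    Real.rpow_mul_natCast (abs_nonneg _)]
  ring

lemma integrable_ouDens (h0 : 0 < H) (h1 : H < 1) : Integrable (ouDens H) := by
  have := integrable_comp_abs (integrableOn_rpow_mul_one_add_sq
    (show 0 < 2 - 2 * H by linarith) (show (2 - 2 * H) / 2 < 1 by linarith))
  exact (this.const_mul (specC H)).congr (Eventually.of_forall fun ξ => (ouDens_eq ξ).symm)

lemma integral_ouDens (h0 : 0 < H) (h1 : H < 1) :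
    ∫ ξ, ouDens H ξ = specC H * (Real.pi / Real.sin (Real.pi * H)) := by
  simp_rw [ouDens_eq]
  rw [integral_const_mul, integral_comp_abs
      (f := fun x => x ^ (2 - 2 * H - 1) * (1 / (1 + x ^ 2)) ^ (1 : ℝ)),
    integral_rpow_mul_one_add_sq (show 0 < 2 - 2 * H by linarith)
    (show (2 - 2 * H) / 2 < 1 by linarith), Real.Gamma_one, ← Real.Gamma_mul_Gamma_one_sub,
    show (2 - 2 * H) / 2 = 1 - H by ring, show 1 - (1 - H) = H by ring]
  ring

/-- The squared density behaves like `|ξ|^(2-4H)` at `0`: this is where `H < 3/4` is needed. -/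
lemma integrable_ouDens_sq (h0 : 0 < H) (h1 : H < 3 / 4) :
    Integrable fun ξ => ouDens H ξ ^ 2 := by
  have := integrable_comp_abs (integrableOn_rpow_mul_one_add_sq
    (show 0 < 3 - 4 * H by linarith) (show (3 - 4 * H) / 2 < 2 by linarith))
  exact (this.const_mul (specC H ^ 2)).congr (Eventually.of_forall fun ξ => (ouDens_sq_eq ξ).symm)

lemma integral_ouDens_sq (h0 : 0 < H) (h1 : H < 3 / 4) :
    ∫ ξ, ouDens H ξ ^ 2
      = specC H ^ 2 * (Real.Gamma (3 / 2 - 2 * H) * Real.Gamma (1 / 2 + 2 * H)) := by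
  simp_rw [ouDens_sq_eq]
  rw [integral_const_mul, integral_comp_abs
      (f := fun x => x ^ (3 - 4 * H - 1) * (1 / (1 + x ^ 2)) ^ (2 : ℝ)),
    integral_rpow_mul_one_add_sq (show 0 < 3 - 4 * H by linarith)
    (show (3 - 4 * H) / 2 < 2 by linarith), Real.Gamma_two,
    show (3 - 4 * H) / 2 = 3 / 2 - 2 * H by ring,
    show 2 - (3 / 2 - 2 * H) = 1 / 2 + 2 * H by ring]
  ring

lemma integrable_cos_mul_ouDens (h0 : 0 < H) (h1 : H < 1) (u : ℝ) :
    Integrable fun ξ => Real.cos (u * ξ) * ouDens H ξ :=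
  (integrable_ouDens h0 h1).bdd_mul (c := 1) (by fun_prop : Continuous fun ξ : ℝ =>
    Real.cos (u * ξ)).aestronglyMeasurable
    (Eventually.of_forall fun ξ => Real.abs_cos_le_one _)

lemma ouCov_zero : ouCov H 0 = ∫ ξ, ouDens H ξ := by simp [ouCov]

lemma ouCov_neg (u : ℝ) : ouCov H (-u) = ouCov H u := by simp [ouCov]

lemma ouCov_zero_pos (h0 : 0 < H) (h1 : H < 1) : 0 < ouCov H 0 := by
  rw [ouCov_zero, integral_ouDens h0 h1]
  have := specC_pos h0 h1
  have : 0 < Real.sin (Real.pi * H) :=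
    Real.sin_pos_of_pos_of_lt_pi (by positivity) (by nlinarith [Real.pi_pos])
  positivity

lemma abs_ouCov_le (h0 : 0 < H) (h1 : H < 1) (u : ℝ) : |ouCov H u| ≤ ouCov H 0 := by
  rw [ouCov_zero, ← Real.norm_eq_abs, ouCov]
  refine norm_integral_le_of_norm_le (integrable_ouDens h0 h1) (Eventually.of_forall fun ξ => ?_)
  rw [norm_mul, Real.norm_of_nonneg (ouDens_nonneg h0 h1 ξ)]
  exact mul_le_of_le_one_left (ouDens_nonneg h0 h1 ξ) (Real.abs_cos_le_one _)

lemma continuous_ouCov (h0 : 0 < H) (h1 : H < 1) : Continuous (ouCov H) := by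
  refine continuous_of_dominated (bound := ouDens H) (fun u => ?_) (fun u => ?_)
    (integrable_ouDens h0 h1) ?_
  · exact (integrable_cos_mul_ouDens h0 h1 u).aestronglyMeasurable
  · refine Eventually.of_forall fun ξ => ?_
    rw [norm_mul, Real.norm_of_nonneg (ouDens_nonneg h0 h1 ξ)]
    exact mul_le_of_le_one_left (ouDens_nonneg h0 h1 ξ) (Real.abs_cos_le_one _)
  · exact Eventually.of_forall fun ξ => by fun_prop

/-- The transform of `h_t` as an explicit function. -/
def hFeatFun (t ξ : ℝ) : ℝ :=
  ((1 - ξ) * Real.cos (t * ξ) + (1 + ξ) * Real.sin (t * ξ) - Real.exp (-t) * (1 - ξ))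
    / (1 + ξ ^ 2)

lemma integral_exp_mul_cas (t ξ : ℝ) :
    ∫ x in (0 : ℝ)..t, Real.exp (x - t) * cas (x * ξ) = hFeatFun t ξ := by
  have hξ : (1 : ℝ) + ξ ^ 2 ≠ 0 := by positivity
  have hd : ∀ x ∈ Set.uIcc 0 t, HasDerivAt (fun x => Real.exp (x - t) *
      ((1 - ξ) * Real.cos (x * ξ) + (1 + ξ) * Real.sin (x * ξ)) / (1 + ξ ^ 2))
      (Real.exp (x - t) * cas (x * ξ)) x := by
    intro x _
    have hl : HasDerivAt (fun x : ℝ => x * ξ) ξ x := by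
      simpa using (hasDerivAt_id x).mul_const ξ
    have he : HasDerivAt (fun x : ℝ => Real.exp (x - t)) (Real.exp (x - t)) x := by
      simpa using ((hasDerivAt_id x).sub_const t).exp
    have h := (he.mul ((hl.cos.const_mul (1 - ξ)).add (hl.sin.const_mul (1 + ξ)))).div_const
      (1 + ξ ^ 2)
    refine h.congr_deriv ?_
    simp only [Pi.add_apply, cas]
    field_simp
    ring
  rw [intervalIntegral.integral_eq_sub_of_hasDerivAt hd
    (Continuous.intervalIntegrable
      ((by fun_prop : Continuous fun x : ℝ => Real.exp (x - t)).mul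
        (continuous_cas.comp (by fun_prop))) _ _)]
  simp only [hFeatFun, sub_self, Real.exp_zero, zero_mul, Real.cos_zero, Real.sin_zero, zero_sub]
  ring

/-- The numerator of `hFeatFun t` is `A_t - e^(-t) A_0` with `A_t = (1-ξ) cos tξ + (1+ξ) sin tξ`.
The even part of `A_s A_t` is `(1+ξ²) cos (t-s)ξ`, which cancels one of the two factors `1+ξ²` in
the denominator; the odd part integrates to `0`. -/
theorem covOU_eq (h0 : 0 < H) (h1 : H < 1) {s t : ℝ} (hs : 0 ≤ s) (ht : 0 ≤ t) :
    covOU h0 h1 s t = ouCov H (t - s) - Real.exp (-t) * ouCov H s - Real.exp (-s) * ouCov H t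
      + Real.exp (-s) * Real.exp (-t) * ouCov H 0 := by
  have hae : ∀ {t : ℝ}, 0 ≤ t → hFeat h0 h1 t =ᵐ[specMeas H] hFeatFun t := fun ht =>
    (hFeat_ae h0 h1 ht).trans (Eventually.of_forall fun ξ => integral_exp_mul_cas _ ξ)
  have hmul : (fun ξ => hFeat h0 h1 s ξ * hFeat h0 h1 t ξ)
      =ᵐ[specMeas H] fun ξ => hFeatFun s ξ * hFeatFun t ξ := (hae hs).mul (hae ht)
  have hi : Integrable (fun ξ => hFeatFun s ξ * hFeatFun t ξ) (specMeas H) :=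
    ((Lp.memLp (hFeat h0 h1 s)).integrable_mul (Lp.memLp (hFeat h0 h1 t))).congr hmul
  rw [covOU, inner_Lp_eq_integral, integral_congr_ae hmul, integral_specMeas h0 h1,
    integral_eq_half_integral_add_neg ((integrable_specMeas_iff h0 h1).1 hi)]
  have hpt : ∀ ξ, specC H * |ξ| ^ (1 - 2 * H) * (hFeatFun s ξ * hFeatFun t ξ)
      + specC H * |-ξ| ^ (1 - 2 * H) * (hFeatFun s (-ξ) * hFeatFun t (-ξ))
      = 2 * (Real.cos ((t - s) * ξ) * ouDens H ξ - Real.exp (-t) * (Real.cos (s * ξ) * ouDens H ξ)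
        - Real.exp (-s) * (Real.cos (t * ξ) * ouDens H ξ)
        + Real.exp (-s) * Real.exp (-t) * (Real.cos (0 * ξ) * ouDens H ξ)) := by
    intro ξ
    have hξ : (1 : ℝ) + ξ ^ 2 ≠ 0 := by positivity
    simp only [hFeatFun, ouDens, abs_neg, mul_neg, neg_sq, Real.cos_neg, Real.sin_neg, zero_mul,
      Real.cos_zero, sub_mul, Real.cos_sub]
    field_simp
    ring
  have i1 := integrable_cos_mul_ouDens h0 h1 (t - s)
  have i2 := (integrable_cos_mul_ouDens h0 h1 s).const_mul (Real.exp (-t))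
  have i3 := (integrable_cos_mul_ouDens h0 h1 t).const_mul (Real.exp (-s))
  have i4 := (integrable_cos_mul_ouDens h0 h1 0).const_mul (Real.exp (-s) * Real.exp (-t))
  simp_rw [hpt]
  rw [integral_const_mul, integral_add (f := fun ξ => Real.cos ((t - s) * ξ) * ouDens H ξ
        - Real.exp (-t) * (Real.cos (s * ξ) * ouDens H ξ)
        - Real.exp (-s) * (Real.cos (t * ξ) * ouDens H ξ)) ((i1.sub i2).sub i3) i4,
    integral_sub (f := fun ξ => Real.cos ((t - s) * ξ) * ouDens H ξ
        - Real.exp (-t) * (Real.cos (s * ξ) * ouDens H ξ)) (i1.sub i2) i3,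
    integral_sub i1 i2, integral_const_mul, integral_const_mul, integral_const_mul]
  simp only [ouCov]
  ring

end OU

/-! ### Decay of the stationary covariance -/

section Decay

variable {H : ℝ}

/-- The second difference of `|·|^p` at `u` with step `x`. -/
def secondDiff (p u x : ℝ) : ℝ := |u + x| ^ p + |u - x| ^ p - 2 * |u| ^ p

/-- It writes `ouDens` as an exponential average over `x` of the functions `osc H x`, whose cosine
transforms are explicit second differences. -/
lemma integral_exp_mul_one_sub_cos (ξ : ℝ) :
    ∫ x in Set.Ioi (0 : ℝ), Real.exp (-x) * (1 - Real.cos (x * ξ)) = ξ ^ 2 / (1 + ξ ^ 2) := by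
  have hξ : (1 : ℝ) + ξ ^ 2 ≠ 0 := by positivity
  have hd : ∀ x : ℝ, HasDerivAt (fun x => Real.exp (-x) *
      ((Real.cos (x * ξ) - ξ * Real.sin (x * ξ)) / (1 + ξ ^ 2) - 1))
      (Real.exp (-x) * (1 - Real.cos (x * ξ))) x := by
    intro x
    have hl : HasDerivAt (fun x : ℝ => x * ξ) ξ x := by
      simpa using (hasDerivAt_id x).mul_const ξ
    have he : HasDerivAt (fun x : ℝ => Real.exp (-x)) (-Real.exp (-x)) x := by
      simpa using (hasDerivAt_id x).neg.exp
    have h := he.mul (((hl.cos.sub (hl.sin.const_mul ξ)).div_const (1 + ξ ^ 2)).sub_const 1)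
    refine h.congr_deriv ?_
    simp only [Pi.sub_apply]
    field_simp
    ring
  have hlim : Tendsto (fun x : ℝ => Real.exp (-x) *
      ((Real.cos (x * ξ) - ξ * Real.sin (x * ξ)) / (1 + ξ ^ 2) - 1)) atTop (𝓝 0) := by
    refine squeeze_zero_norm (a := fun x => Real.exp (-x) * ((1 + |ξ|) / (1 + ξ ^ 2) + 1))
      (fun x => ?_) ?_
    · rw [norm_mul, Real.norm_of_nonneg (Real.exp_pos _).le]
      gcongr
      refine (norm_sub_le _ _).trans ?_
      rw [norm_one, norm_div, Real.norm_of_nonneg (by positivity : (0 : ℝ) ≤ 1 + ξ ^ 2)]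
      gcongr
      refine (norm_sub_le _ _).trans ?_
      rw [norm_mul]
      exact add_le_add (Real.abs_cos_le_one _)
        (mul_le_of_le_one_right (abs_nonneg _) (Real.abs_sin_le_one _))
    · simpa using (Real.tendsto_exp_neg_atTop_nhds_zero.mul_const ((1 + |ξ|) / (1 + ξ ^ 2) + 1))
  rw [integral_Ioi_of_hasDerivAt_of_nonneg (hd 0).continuousAt.continuousWithinAt
    (fun x _ => hd x) (fun x _ => mul_nonneg (Real.exp_pos _).le
      (sub_nonneg.2 (Real.cos_le_one _))) hlim]
  simp
  field_simp
  ring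

lemma integral_cos_mul_osc (h0 : 0 < H) (h1 : H < 1) (u x : ℝ) :
    ∫ ξ, specC H * (Real.cos (u * ξ) * osc H x ξ) = secondDiff (2 * H) u x / 4 := by
  have hpt : ∀ ξ, specC H * (Real.cos (u * ξ) * osc H x ξ)
      = specC H / 2 * (osc H (u + x) ξ + osc H (u - x) ξ - 2 * osc H u ξ) := by
    intro ξ
    simp only [osc, add_mul, sub_mul, Real.cos_add, Real.cos_sub]
    ring
  simp_rw [hpt]
  rw [integral_const_mul, integral_sub
    (f := fun ξ => osc H (u + x) ξ + osc H (u - x) ξ)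
    ((integrable_osc h0 h1 _).add (integrable_osc h0 h1 _)) ((integrable_osc h0 h1 _).const_mul 2),
    integral_add (integrable_osc h0 h1 _) (integrable_osc h0 h1 _), integral_const_mul, secondDiff]
  linear_combination (specC_mul_integral_osc h0 h1 (u + x) + specC_mul_integral_osc h0 h1 (u - x)
    - 2 * specC_mul_integral_osc h0 h1 u) / 2

lemma integrable_exp_mul_osc (h0 : 0 < H) (h1 : H < 1) :
    Integrable (Function.uncurry fun x ξ : ℝ => Real.exp (-x) * (specC H * osc H x ξ))
      ((volume.restrict (Set.Ioi 0)).prod volume) := by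
  have hm : Measurable (Function.uncurry fun x ξ : ℝ =>
      Real.exp (-x) * (specC H * osc H x ξ)) := by
    unfold Function.uncurry osc
    fun_prop
  have hc := (specC_pos h0 h1).le
  refine (integrable_prod_iff hm.aestronglyMeasurable).2 ⟨?_, ?_⟩
  · refine Eventually.of_forall fun x => ?_
    change Integrable fun ξ => Real.exp (-x) * (specC H * osc H x ξ)
    exact ((integrable_osc h0 h1 x).const_mul _).const_mul _
  · have hi : IntegrableOn (fun x => Real.exp (-x) * x ^ (2 * H + 1 - 1) * (1 / 2)) (Set.Ioi 0) :=
      (Real.GammaIntegral_convergent (by linarith)).mul_const _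
    refine hi.congr_fun (fun x hx => ?_) measurableSet_Ioi
    have hx : 0 < x := hx
    have : ∀ ξ, ‖Function.uncurry (fun x ξ : ℝ => Real.exp (-x) * (specC H * osc H x ξ)) (x, ξ)‖
        = Real.exp (-x) * (specC H * osc H x ξ) := fun ξ =>
      Real.norm_of_nonneg (mul_nonneg (Real.exp_pos _).le (mul_nonneg hc (osc_nonneg H x ξ)))
    simp only [this]
    rw [integral_const_mul, integral_const_mul, specC_mul_integral_osc h0 h1, abs_of_pos hx,
      add_sub_cancel_right]
    ring

/-- The covariance of the stationary process through second differences of `|·|^{2H}`. -/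
lemma ouCov_eq_integral_secondDiff (h0 : 0 < H) (h1 : H < 1) (u : ℝ) :
    ouCov H u = ∫ x in Set.Ioi (0 : ℝ), Real.exp (-x) * (secondDiff (2 * H) u x / 4) := by
  have hi : Integrable (Function.uncurry fun x ξ : ℝ =>
      Real.cos (u * ξ) * (Real.exp (-x) * (specC H * osc H x ξ)))
      ((volume.restrict (Set.Ioi 0)).prod volume) := by
    refine (integrable_exp_mul_osc h0 h1).bdd_mul (c := 1)
      (f := fun p : ℝ × ℝ => Real.cos (u * p.2)) ?_ ?_
    · exact (by fun_prop : Continuous fun p : ℝ × ℝ => Real.cos (u * p.2)).aestronglyMeasurable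
    · exact Eventually.of_forall fun ξ => Real.abs_cos_le_one _
  -- Integrating in `ξ` first gives second differences; integrating in `x` first gives the spectral
  -- density.
  have hsw := integral_integral_swap hi
  have hl : ∀ x, ∫ ξ, Real.cos (u * ξ) * (Real.exp (-x) * (specC H * osc H x ξ))
      = Real.exp (-x) * (secondDiff (2 * H) u x / 4) := by
    intro x
    rw [← integral_cos_mul_osc h0 h1, ← integral_const_mul]
    exact integral_congr_ae (Eventually.of_forall fun ξ => by ring)
  simp_rw [hl] at hsw
  rw [hsw, ouCov]
  refine integral_congr_ae ?_
  filter_upwards [compl_mem_ae_iff.2 (measure_singleton (0 : ℝ))] with ξ hξ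
  have hξ' : ξ ≠ 0 := hξ
  have hpt : ∀ x, Real.cos (u * ξ) * (Real.exp (-x) * (specC H * osc H x ξ))
      = Real.cos (u * ξ) * (specC H * |ξ| ^ (-1 - 2 * H))
        * (Real.exp (-x) * (1 - Real.cos (x * ξ))) := by
    intro x
    simp only [osc]
    ring
  simp_rw [hpt]
  rw [integral_const_mul, integral_exp_mul_one_sub_cos, ouDens, rpow_abs_eq hξ']
  ring

lemma abs_rpow_eq_sq_rpow (p x : ℝ) : |x| ^ p = (x ^ 2) ^ (p / 2) := by
  rw [← sq_abs, ← Real.rpow_two, ← Real.rpow_mul (abs_nonneg _)]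
  congr 1
  ring

/-- Put `q = p/2 ≤ 1`, `a = (1+y)²`, `b = (1-y)²`. Above, concavity of the `q`-th power at the mean
`1+y²` of `a` and `b` suffices. Below, for `y² < 1`, the inequality of means gives `a^q + b^q ≥
2(1-y²)^q ≥ 2(1-y²)`; for `y² ≥ 1` the bound `-2` is enough. The singularity of the power at `y =
±1` thus needs no separate treatment. -/
lemma abs_secondDiff_one_le {p : ℝ} (hp0 : 0 < p) (hp2 : p ≤ 2) (y : ℝ) :
    |secondDiff p 1 y| ≤ 2 * y ^ 2 := by
  have hq0 : 0 ≤ p / 2 := by linarith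
  have hq1 : p / 2 ≤ 1 := by linarith
  rw [secondDiff, abs_one, Real.one_rpow, abs_rpow_eq_sq_rpow, abs_rpow_eq_sq_rpow, abs_le]
  set a := (1 + y) ^ 2 with ha
  set b := (1 - y) ^ 2 with hb
  have ha0 : 0 ≤ a := sq_nonneg _
  have hb0 : 0 ≤ b := sq_nonneg _
  constructor
  · by_cases hy : 1 ≤ y ^ 2
    · have h1 : 0 ≤ a ^ (p / 2) := by positivity
      have h2 : 0 ≤ b ^ (p / 2) := by positivity
      linarith
    · have hy' : 0 < 1 - y ^ 2 := by linarith
      have hy1 : 1 - y ^ 2 ≤ 1 := by nlinarith [sq_nonneg y]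
      have hprod : a ^ (p / 2) * b ^ (p / 2) = ((1 - y ^ 2) ^ (p / 2)) ^ 2 := by
        rw [← Real.mul_rpow ha0 hb0, ← Real.rpow_mul_natCast hy'.le, mul_comm (p / 2),
          Real.rpow_mul hy'.le, ha, hb]
        congr 1
        rw [Nat.cast_ofNat, Real.rpow_two]
        ring
      have hle : 1 - y ^ 2 ≤ (1 - y ^ 2) ^ (p / 2) := by
        have := Real.rpow_le_rpow_of_exponent_ge hy' hy1 hq1
        rwa [Real.rpow_one] at this
      have h1 : 0 ≤ a ^ (p / 2) := by positivity
      have h2 : 0 ≤ b ^ (p / 2) := by positivity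
      have h3 : 0 ≤ (1 - y ^ 2) ^ (p / 2) := by positivity
      have h4 : 2 * (1 - y ^ 2) ^ (p / 2) ≤ a ^ (p / 2) + b ^ (p / 2) := by
        refine abs_le_of_sq_le_sq' ?_ (by positivity) |>.2
        nlinarith [sq_nonneg (a ^ (p / 2) - b ^ (p / 2))]
      linarith
  · have hconc := (Real.concaveOn_rpow hq0 hq1).2 (Set.mem_Ici.2 ha0) (Set.mem_Ici.2 hb0)
      (show (0 : ℝ) ≤ 1 / 2 by norm_num) (show (0 : ℝ) ≤ 1 / 2 by norm_num) (by norm_num)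
    simp only [smul_eq_mul] at hconc
    have hab : 1 / 2 * a + 1 / 2 * b = 1 + y ^ 2 := by rw [ha, hb]; ring
    rw [hab] at hconc
    have hle : (1 + y ^ 2) ^ (p / 2) ≤ 1 + y ^ 2 := by
      have := Real.rpow_le_rpow_of_exponent_le (show 1 ≤ 1 + y ^ 2 by nlinarith [sq_nonneg y]) hq1
      rwa [Real.rpow_one] at this
    linarith

lemma abs_secondDiff_le {p u : ℝ} (hp0 : 0 < p) (hp2 : p ≤ 2) (hu : 0 < u) (x : ℝ) :
    |secondDiff p u x| ≤ 2 * x ^ 2 * u ^ (p - 2) := by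
  have h : secondDiff p u x = u ^ p * secondDiff p 1 (x / u) := by
    have e1 : |u + x| ^ p = u ^ p * |1 + x / u| ^ p := by
      rw [← Real.mul_rpow hu.le (abs_nonneg _), show u + x = u * (1 + x / u) by field_simp,
        abs_mul, abs_of_pos hu]
    have e2 : |u - x| ^ p = u ^ p * |1 - x / u| ^ p := by
      rw [← Real.mul_rpow hu.le (abs_nonneg _), show u - x = u * (1 - x / u) by field_simp,
        abs_mul, abs_of_pos hu]
    rw [secondDiff, secondDiff, e1, e2, abs_one, Real.one_rpow, abs_of_pos hu]
    ring
  rw [h, abs_mul, abs_of_pos (by positivity), Real.rpow_sub hu, Real.rpow_two]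
  calc u ^ p * |secondDiff p 1 (x / u)| ≤ u ^ p * (2 * (x / u) ^ 2) := by
        gcongr
        exact abs_secondDiff_one_le hp0 hp2 _
    _ = _ := by field_simp

/-- The second difference of `|·|` vanishes for `x ≤ u`, and for `x ≥ u` it is at most `2x ≤ 2x
(x/u)²`. One more power of `x` buys one more order of decay in `u`. -/
lemma abs_secondDiff_of_exponent_one_le {u x : ℝ} (hu : 0 < u) (hx : 0 < x) :
    |secondDiff 1 u x| ≤ 2 * x ^ 3 * u ^ (-2 : ℝ) := by
  have hu2 : u ^ (-2 : ℝ) = (u ^ 2)⁻¹ := by rw [Real.rpow_neg hu.le, Real.rpow_two]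
  simp only [secondDiff, Real.rpow_one, abs_of_pos hu, abs_of_pos (add_pos hu hx), hu2]
  rcases le_total x u with h | h
  · rw [abs_of_nonneg (sub_nonneg.2 h), show u + x + (u - x) - 2 * u = 0 by ring, abs_zero]
    positivity
  · rw [abs_of_nonpos (sub_nonpos.2 h), abs_of_nonneg (by linarith), ← div_eq_mul_inv,
      le_div_iff₀ (by positivity)]
    have : u ^ 2 ≤ x ^ 2 := by gcongr
    nlinarith [mul_le_mul (show u + x + -(u - x) - 2 * u ≤ 2 * x by linarith) this
      (by positivity) (by positivity)]

/-- The factorial is `∫ e^(-x) x^n` over the half-line. -/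
lemma abs_ouCov_le_of_secondDiff (h0 : 0 < H) (h1 : H < 1) {u A : ℝ} (n : ℕ)
    (h : ∀ x, 0 < x → |secondDiff (2 * H) u x| ≤ 2 * x ^ n * A) :
    |ouCov H u| ≤ (n.factorial : ℝ) / 2 * A := by
  have hi : IntegrableOn (fun x : ℝ => A / 2 * (Real.exp (-x) * x ^ ((n : ℝ) + 1 - 1)))
      (Set.Ioi 0) := (Real.GammaIntegral_convergent (by positivity)).const_mul _
  rw [ouCov_eq_integral_secondDiff h0 h1, ← Real.norm_eq_abs]
  refine (norm_integral_le_of_norm_le hi ?_).trans_eq ?_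
  · filter_upwards [ae_restrict_mem measurableSet_Ioi] with x hx
    rw [norm_mul, Real.norm_of_nonneg (Real.exp_pos _).le, norm_div, Real.norm_eq_abs,
      add_sub_cancel_right, Real.rpow_natCast, Real.norm_of_nonneg (by norm_num : (0 : ℝ) ≤ 4)]
    have := h x hx
    calc Real.exp (-x) * (|secondDiff (2 * H) u x| / 4)
        ≤ Real.exp (-x) * ((2 * x ^ n * A) / 4) := by gcongr
      _ = _ := by ring
  · rw [integral_const_mul, ← Real.Gamma_eq_integral (by positivity), Real.Gamma_nat_eq_factorial]
    ring

lemma abs_ouCov_le_rpow (h0 : 0 < H) (h1 : H < 1) {u : ℝ} (hu : 0 < u) :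
    |ouCov H u| ≤ u ^ (2 * H - 2) := by
  have := abs_ouCov_le_of_secondDiff h0 h1 (u := u) 2 fun x _ =>
    abs_secondDiff_le (by linarith) (by linarith) hu x
  simpa using this

lemma abs_ouCov_half_le {u : ℝ} (hu : 0 < u) : |ouCov (1 / 2) u| ≤ 3 * u ^ (-2 : ℝ) := by
  have := abs_ouCov_le_of_secondDiff (H := 1 / 2) (by norm_num) (by norm_num) (u := u)
    (A := u ^ (-2 : ℝ)) 3 fun x hx => by
      rw [show (2 : ℝ) * (1 / 2) = 1 by norm_num]
      exact abs_secondDiff_of_exponent_one_le hu hx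
  refine this.trans_eq ?_
  norm_num [Nat.factorial]

end Decay

/-! ### Plancherel's theorem for integrable functions in `L²` -/

section Plancherel

open FourierTransform SchwartzMap
open scoped ContDiff

/-- The `L²` Fourier transform of an integrable function is its Fourier integral. -/
lemma coeFn_fourier_toLp {f : ℝ → ℂ} (hf1 : Integrable f) (hf2 : MemLp f 2) :
    (𝓕 (hf2.toLp f) : Lp ℂ 2 (volume : Measure ℝ)) =ᵐ[volume] 𝓕 f := by
  have hcont : Continuous (𝓕 f) :=
    VectorFourier.fourierIntegral_continuous Real.continuous_fourierChar
      continuous_inner hf1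
  -- Both sides are locally integrable, so it suffices to test against smooth compactly supported
  -- functions. There the `L²` transform acts by duality, and Fubini moves the Fourier integral from
  -- the test function to `f`.
  refine ae_eq_of_integral_contDiff_smul_eq ((Lp.memLp _).locallyIntegrable one_le_two)
    hcont.locallyIntegrable fun g g_smooth g_cpt => ?_
  have hg₁ : HasCompactSupport (Complex.ofRealCLM ∘ g) := g_cpt.comp_left rfl
  have hg₂ : ContDiff ℝ ∞ (Complex.ofRealCLM ∘ g) := by fun_prop
  set φ : 𝓢(ℝ, ℂ) := hg₁.toSchwartzMap hg₂ with hφ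
  have e1 : ∫ x, g x • (𝓕 (hf2.toLp f) : Lp ℂ 2 (volume : Measure ℝ)) x
      = Lp.toTemperedDistribution (𝓕 (hf2.toLp f) : Lp ℂ 2 (volume : Measure ℝ)) φ := by
    rw [Lp.toTemperedDistribution_apply]
    simp [hφ]
  rw [e1, ← Lp.fourier_toTemperedDistribution_eq, TemperedDistribution.fourier_apply,
    Lp.toTemperedDistribution_apply]
  have e2 : ∫ x, 𝓕 φ x • (hf2.toLp f) x = ∫ x, 𝓕 φ x • f x := by
    refine integral_congr_ae ?_
    filter_upwards [hf2.coeFn_toLp] with x hx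
    rw [hx]
  rw [e2]
  have e3 := VectorFourier.integral_fourierIntegral_smul_eq_flip (L := innerₗ ℝ)
    (μ := volume) (ν := volume) Real.continuous_fourierChar continuous_inner
    φ.integrable hf1
  rw [flip_innerₗ] at e3
  rw [SchwartzMap.fourier_coe]
  refine e3.trans (integral_congr_ae (Eventually.of_forall fun x => ?_))
  simp only [hφ, HasCompactSupport.toSchwartzMap_toFun, Function.comp_apply,
    Complex.ofRealCLM_apply, Complex.real_smul, smul_eq_mul]
  rfl

lemma memLp_fourier {f : ℝ → ℂ} (hf1 : Integrable f) (hf2 : MemLp f 2) : MemLp (𝓕 f) 2 :=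
  (memLp_congr_ae (coeFn_fourier_toLp hf1 hf2)).1 (Lp.memLp _)

/-- Plancherel's theorem for integrable square-integrable functions. -/
lemma integral_norm_sq_fourier {f : ℝ → ℂ} (hf1 : Integrable f) (hf2 : MemLp f 2) :
    ∫ v, ‖𝓕 f v‖ ^ 2 = ∫ x, ‖f x‖ ^ 2 := by
  have h : ∀ (g : Lp ℂ 2 (volume : Measure ℝ)), ‖g‖ ^ 2 = ∫ x, ‖g x‖ ^ 2 := fun g => by
    rw [← real_inner_self_eq_norm_sq, L2.inner_def]
    simp
  have h1 := Lp.norm_fourier_eq (hf2.toLp f)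
  have h2 : ‖(𝓕 (hf2.toLp f) : Lp ℂ 2 (volume : Measure ℝ))‖ ^ 2 = ‖hf2.toLp f‖ ^ 2 := by rw [h1]
  rw [h, h] at h2
  refine Eq.trans (integral_congr_ae ?_) (h2.trans (integral_congr_ae ?_))
  · filter_upwards [coeFn_fourier_toLp hf1 hf2] with x hx
    rw [hx]
  · filter_upwards [hf2.coeFn_toLp] with x hx
    rw [hx]

lemma fourier_ofReal_of_even {m : ℝ → ℝ} (hm : Integrable m) (heven : ∀ x, m (-x) = m x) (v : ℝ) :
    𝓕 (fun x => (m x : ℂ)) v = ((∫ x, Real.cos (2 * Real.pi * v * x) * m x : ℝ) : ℂ) := by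
  set F : ℝ → ℂ := fun x => Complex.exp ((-2 * Real.pi * x * v : ℝ) * Complex.I) * (m x : ℂ)
    with hF
  have hFi : Integrable F := by
    refine hm.ofReal.bdd_mul (c := 1) (Continuous.aestronglyMeasurable (by fun_prop)) ?_
    exact Eventually.of_forall fun x => (Complex.norm_exp_ofReal_mul_I _).le
  have e1 : 𝓕 (fun x => (m x : ℂ)) v = ∫ x, F x := by
    rw [Real.fourier_eq']
    refine integral_congr_ae (Eventually.of_forall fun x => ?_)
    simp only [hF, smul_eq_mul, RCLike.inner_apply, conj_trivial]
    congr 3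
    push_cast
    ring
  have e2 : ∫ x, F x = (1 / 2 : ℂ) * ∫ x, (F x + F (-x)) := by
    rw [integral_add hFi hFi.comp_neg, integral_neg_eq_self F]
    ring
  rw [e1, e2, ← integral_const_mul, ← integral_complex_ofReal]
  refine integral_congr_ae (Eventually.of_forall fun x => ?_)
  simp only [hF, heven, Complex.exp_mul_I, ← Complex.ofReal_cos, ← Complex.ofReal_sin]
  rw [show -2 * Real.pi * x * v = -(2 * Real.pi * v * x) by ring,
    show -2 * Real.pi * -x * v = 2 * Real.pi * v * x by ring, Real.cos_neg, Real.sin_neg]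
  push_cast
  ring

end Plancherel

/-! ### The limiting constant -/

section Constant

variable {H : ℝ}

open FourierTransform in
lemma fourier_ouDens (h0 : 0 < H) (h1 : H < 1) (v : ℝ) :
    𝓕 (fun x => (ouDens H x : ℂ)) v = (ouCov H (2 * Real.pi * v) : ℂ) :=
  fourier_ofReal_of_even (integrable_ouDens h0 h1) ouDens_neg v

lemma memLp_ouDens (h0 : 0 < H) (h1 : H < 3 / 4) : MemLp (fun x => (ouDens H x : ℂ)) 2 :=
  ((memLp_two_iff_integrable_sq measurable_ouDens.aestronglyMeasurable).2
    (integrable_ouDens_sq h0 h1)).ofReal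

lemma integrable_ofReal_ouDens (h0 : 0 < H) (h1 : H < 1) :
    Integrable fun x => (ouDens H x : ℂ) := (integrable_ouDens h0 h1).ofReal

lemma integrable_ouCov_sq (h0 : 0 < H) (h1 : H < 3 / 4) : Integrable fun u => ouCov H u ^ 2 := by
  have h1' : H < 1 := by linarith
  have h := memLp_fourier (integrable_ofReal_ouDens h0 h1') (memLp_ouDens h0 h1)
  have h2 := h.integrable_norm_pow two_ne_zero
  simp only [fourier_ouDens h0 h1', Complex.norm_real, Real.norm_eq_abs, sq_abs] at h2
  exact (integrable_comp_mul_left_iff (fun u => ouCov H u ^ 2)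
    (by positivity : 2 * Real.pi ≠ 0)).1 h2

lemma integral_ouCov_sq (h0 : 0 < H) (h1 : H < 3 / 4) :
    ∫ u, ouCov H u ^ 2 = 2 * Real.pi * ∫ ξ, ouDens H ξ ^ 2 := by
  have h1' : H < 1 := by linarith
  have h := integral_norm_sq_fourier (integrable_ofReal_ouDens h0 h1') (memLp_ouDens h0 h1)
  simp only [fourier_ouDens h0 h1', Complex.norm_real, Real.norm_eq_abs, sq_abs] at h
  rw [Measure.integral_comp_mul_left (fun u => ouCov H u ^ 2), smul_eq_mul,
    abs_of_pos (by positivity)] at h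
  rw [← h]
  field_simp

/-- After Plancherel both sides carry `specC H ^ 2`, which cancels. Away from `H = 1/4` the identity
is the reflection formula at `x = 2H - 1/2` together with `1 - cos 2πH = 2 sin² πH`; at `H = 1/4`
both Gamma values are `1`. -/
theorem two_mul_integral_ouCov_sq (h0 : 0 < H) (h1 : H < 3 / 4) :
    2 * ∫ u, ouCov H u ^ 2 = sigmaSq H * ouCov H 0 ^ 2 := by
  have h1' : H < 1 := by linarith
  rw [integral_ouCov_sq h0 h1, integral_ouDens_sq h0 h1, ouCov_zero, integral_ouDens h0 h1',
    sigmaSq]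
  have hpi := Real.pi_pos
  split_ifs with hH
  · subst hH
    have hs : Real.sin (Real.pi * (1 / 4)) ^ 2 = 1 / 2 := by
      rw [show Real.pi * (1 / 4) = Real.pi / 4 by ring, Real.sin_pi_div_four, div_pow,
        Real.sq_sqrt (by norm_num)]
      norm_num
    rw [show (3 : ℝ) / 2 - 2 * (1 / 4) = 1 by norm_num,
      show (1 : ℝ) / 2 + 2 * (1 / 4) = 1 by norm_num, Real.Gamma_one, mul_pow, div_pow, hs]
    field_simp
  · have hx : 2 * H - 1 / 2 ≠ 0 := fun h => hH (by linarith)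
    have hsin : Real.sin (Real.pi * (2 * H - 1 / 2)) = -Real.cos (2 * H * Real.pi) := by
      rw [show Real.pi * (2 * H - 1 / 2) = 2 * H * Real.pi - Real.pi / 2 by ring,
        Real.sin_sub_pi_div_two]
    -- `2H - 1/2` lies in `(-1/2, 1)` and is not `0`, so the sine of `π` times it does not vanish.
    have hcos : Real.cos (2 * H * Real.pi) ≠ 0 := by
      intro hc
      rw [hc, neg_zero] at hsin
      rcases lt_or_gt_of_ne hx with h | h
      · exact (Real.sin_neg_of_neg_of_neg_pi_lt (mul_neg_of_pos_of_neg hpi h)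
          (by nlinarith)).ne hsin
      · exact (Real.sin_pos_of_pos_of_lt_pi (mul_pos hpi h) (by nlinarith)).ne' hsin
    have hsH : Real.sin (Real.pi * H) ≠ 0 :=
      (Real.sin_pos_of_pos_of_lt_pi (by positivity) (by nlinarith)).ne'
    have hG : Real.Gamma (3 / 2 - 2 * H) * Real.Gamma (1 / 2 + 2 * H)
        = -((2 * H - 1 / 2) * Real.pi / Real.cos (2 * H * Real.pi)) := by
      have hr := Real.Gamma_mul_Gamma_one_sub (2 * H - 1 / 2)
      rw [hsin] at hr
      rw [show 1 / 2 + 2 * H = (2 * H - 1 / 2) + 1 by ring, Real.Gamma_add_one hx,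
        show 3 / 2 - 2 * H = 1 - (2 * H - 1 / 2) by ring]
      rw [div_neg] at hr
      linear_combination (2 * H - 1 / 2) * hr
    have hdbl : Real.cos (2 * H * Real.pi) = 1 - 2 * Real.sin (Real.pi * H) ^ 2 := by
      rw [show 2 * H * Real.pi = 2 * (Real.pi * H) by ring, Real.cos_two_mul, Real.cos_sq']
      ring
    rw [hG]
    have hfac : 1 - 1 / Real.cos (2 * H * Real.pi)
        = -(2 * Real.sin (Real.pi * H) ^ 2) / Real.cos (2 * H * Real.pi) := by
      rw [eq_div_iff hcos, sub_mul, one_div_mul_cancel hcos, hdbl]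
      ring
    rw [hfac]
    field_simp
    ring

end Constant

/-! ### Comparison with the stationary covariance -/

section Estimates

/-- Used with `z = r(t-s)`, `x = r(s)`, `y = r(t)`, `c = r(0)`, `a = e^(-t)`, `b = e^(-s)`. Cross
terms contribute `a(z²+x²)`, `b(z²+y²)` and `2c²ba`; the squared correction contributes three times
`ax² + by² + c²ba`, since `a² ≤ a` and likewise for `b` and `ba`. Every term keeps a damping factor,
so its double integral stays bounded in `T`. -/
lemma abs_sq_sub_sq_le_of_perturbation {a b c x y z : ℝ} (ha : 0 ≤ a) (ha1 : a ≤ 1) (hb : 0 ≤ b)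
    (hb1 : b ≤ 1) (hz : |z| ≤ c) :
    |(z - a * x - b * y + b * a * c) ^ 2 - z ^ 2|
      ≤ a * (4 * x ^ 2 + z ^ 2) + b * (4 * y ^ 2 + z ^ 2) + 5 * c ^ 2 * (b * a) := by
  have hc : 0 ≤ c := (abs_nonneg z).trans hz
  have hab : 0 ≤ b * a := mul_nonneg hb ha
  have hab1 : b * a ≤ 1 := mul_le_one₀ hb1 ha ha1
  have h1 : |2 * z * (a * x)| ≤ a * (z ^ 2 + x ^ 2) := by
    rw [show 2 * z * (a * x) = a * (2 * z * x) by ring, abs_mul, abs_of_nonneg ha]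
    gcongr
    rw [abs_le]
    constructor <;> nlinarith [sq_nonneg (z + x), sq_nonneg (z - x)]
  have h2 : |2 * z * (b * y)| ≤ b * (z ^ 2 + y ^ 2) := by
    rw [show 2 * z * (b * y) = b * (2 * z * y) by ring, abs_mul, abs_of_nonneg hb]
    gcongr
    rw [abs_le]
    constructor <;> nlinarith [sq_nonneg (z + y), sq_nonneg (z - y)]
  have h3 : |2 * z * (b * a * c)| ≤ 2 * c ^ 2 * (b * a) := by
    rw [show 2 * z * (b * a * c) = 2 * (b * a) * c * z by ring, abs_mul,
      abs_of_nonneg (by positivity)]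
    nlinarith [mul_le_mul_of_nonneg_left hz (by positivity : 0 ≤ 2 * (b * a) * c)]
  have h4 : (-(a * x) - b * y + b * a * c) ^ 2
      ≤ 3 * (a * x ^ 2 + b * y ^ 2 + c ^ 2 * (b * a)) := by
    have e1 : (a * x) ^ 2 ≤ a * x ^ 2 := by
      rw [mul_pow, sq a]; nlinarith [mul_nonneg (mul_nonneg ha (sub_nonneg.2 ha1)) (sq_nonneg x)]
    have e2 : (b * y) ^ 2 ≤ b * y ^ 2 := by
      rw [mul_pow, sq b]; nlinarith [mul_nonneg (mul_nonneg hb (sub_nonneg.2 hb1)) (sq_nonneg y)]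
    have e3 : (b * a * c) ^ 2 ≤ c ^ 2 * (b * a) := by
      rw [mul_pow, sq (b * a)]
      nlinarith [mul_nonneg (mul_nonneg hab (sub_nonneg.2 hab1)) (sq_nonneg c)]
    nlinarith [sq_nonneg (a * x - b * y), sq_nonneg (a * x + b * a * c),
      sq_nonneg (b * y + b * a * c)]
  have h5 := sq_nonneg (-(a * x) - b * y + b * a * c)
  rw [abs_le] at h1 h2 h3 ⊢
  constructor <;> nlinarith

lemma integral_exp_neg_le (T : ℝ) : ∫ t in (0 : ℝ)..T, Real.exp (-t) ≤ 1 := by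
  rw [intervalIntegral.integral_comp_neg (fun t => Real.exp t), integral_exp]
  simp [Real.exp_nonneg]

lemma intervalIntegral_swap {f : ℝ → ℝ → ℝ} (hf : Continuous (Function.uncurry f)) {T : ℝ}
    (hT : 0 ≤ T) : ∫ s in (0 : ℝ)..T, ∫ t in (0 : ℝ)..T, f s t
      = ∫ t in (0 : ℝ)..T, ∫ s in (0 : ℝ)..T, f s t := by
  simp only [intervalIntegral.integral_of_le hT]
  refine integral_integral_swap ?_
  rw [Measure.prod_restrict]
  exact (hf.continuousOn.integrableOn_compact (isCompact_Icc.prod isCompact_Icc)).mono_set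
    (Set.prod_mono Set.Ioc_subset_Icc_self Set.Ioc_subset_Icc_self)

variable {H : ℝ}

/-- `∫ r²` over the real line, `r` the covariance of the stationary process. -/
def covSqMass (H : ℝ) : ℝ := ∫ u, ouCov H u ^ 2

lemma covSqMass_nonneg : 0 ≤ covSqMass H := integral_nonneg fun _ => sq_nonneg _

lemma integral_ouCov_sq_shift_le (h0 : 0 < H) (h1 : H < 3 / 4) {T : ℝ} (hT : 0 ≤ T) (s : ℝ) :
    ∫ t in (0 : ℝ)..T, ouCov H (t - s) ^ 2 ≤ covSqMass H := by
  rw [intervalIntegral.integral_of_le hT, covSqMass,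
    ← integral_sub_right_eq_self (fun u => ouCov H u ^ 2) s]
  exact setIntegral_le_integral ((integrable_ouCov_sq h0 h1).comp_sub_right s)
    (Eventually.of_forall fun _ => sq_nonneg _)

lemma abs_covOU_sub_le (h0 : 0 < H) (h1 : H < 1) {s t : ℝ} (ht : 0 ≤ t) (hts : t ≤ s) :
    |covOU h0 h1 s t - ouCov H (t - s)| ≤ 3 * ouCov H 0 * Real.exp (-t) := by
  rw [covOU_eq h0 h1 (ht.trans hts) ht]
  have hr := (ouCov_zero_pos h0 h1).le
  have ha : 0 ≤ Real.exp (-t) := (Real.exp_pos _).le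
  have hb : 0 ≤ Real.exp (-s) := (Real.exp_pos _).le
  have hb1 : Real.exp (-s) ≤ 1 := Real.exp_le_one_iff.2 (by linarith)
  have hba : Real.exp (-s) ≤ Real.exp (-t) := Real.exp_le_exp.2 (by linarith)
  have e1 : |Real.exp (-t) * ouCov H s| ≤ ouCov H 0 * Real.exp (-t) := by
    rw [abs_mul, abs_of_nonneg ha, mul_comm]
    exact mul_le_mul_of_nonneg_right (abs_ouCov_le h0 h1 s) ha
  have e2 : |Real.exp (-s) * ouCov H t| ≤ ouCov H 0 * Real.exp (-t) := by
    rw [abs_mul, abs_of_nonneg hb, mul_comm]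
    exact mul_le_mul (abs_ouCov_le h0 h1 t) hba hb hr
  have e3 : |Real.exp (-s) * Real.exp (-t) * ouCov H 0| ≤ ouCov H 0 * Real.exp (-t) := by
    rw [abs_of_nonneg (by positivity)]
    nlinarith [mul_nonneg (mul_nonneg ha hr) (sub_nonneg.2 hb1)]
  rw [abs_le] at e1 e2 e3 ⊢
  constructor <;> linarith

lemma continuous_covOU_right (h0 : 0 < H) (h1 : H < 1) (s : ℝ) :
    Continuous fun t => covOU h0 h1 s t := by
  unfold covOU
  exact continuous_const.inner (continuous_hFeat h0 h1)

lemma integral_covOU_sq_le (h0 : 0 < H) (h1 : H < 3 / 4) (h1' : H < 1) {T : ℝ} (hT : 0 ≤ T) :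
    ∫ t in (0 : ℝ)..T, covOU h0 h1' T t ^ 2 ≤ 2 * covSqMass H + 18 * ouCov H 0 ^ 2 := by
  have hc := continuous_ouCov h0 h1'
  have i1 : IntervalIntegrable (fun t => 2 * ouCov H (t - T) ^ 2) volume 0 T :=
    Continuous.intervalIntegrable (by fun_prop) _ _
  have i2 : IntervalIntegrable (fun t => 18 * ouCov H 0 ^ 2 * Real.exp (-t)) volume 0 T :=
    Continuous.intervalIntegrable (by fun_prop) _ _
  have h : ∫ t in (0 : ℝ)..T, covOU h0 h1' T t ^ 2
      ≤ ∫ t in (0 : ℝ)..T, (2 * ouCov H (t - T) ^ 2 + 18 * ouCov H 0 ^ 2 * Real.exp (-t)) := by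
    refine intervalIntegral.integral_mono_on hT
      (((continuous_covOU_right h0 h1' T).pow 2).intervalIntegrable _ _) (i1.add i2)
      fun t ht => ?_
    have hd := abs_covOU_sub_le h0 h1' ht.1 ht.2
    have he : Real.exp (-t) ≤ 1 := Real.exp_le_one_iff.2 (by linarith [ht.1])
    have he0 := Real.exp_pos (-t)
    have hsq : (covOU h0 h1' T t - ouCov H (t - T)) ^ 2 ≤ 9 * ouCov H 0 ^ 2 * Real.exp (-t) := by
      rw [← sq_abs]
      calc |covOU h0 h1' T t - ouCov H (t - T)| ^ 2
          ≤ (3 * ouCov H 0 * Real.exp (-t)) ^ 2 := by gcongr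
        _ = 9 * ouCov H 0 ^ 2 * (Real.exp (-t) * Real.exp (-t)) := by ring
        _ ≤ 9 * ouCov H 0 ^ 2 * (Real.exp (-t) * 1) := by gcongr
        _ = _ := by ring
    -- This is `ρ² ≤ 2r² + 2(ρ - r)²`; the difference of the two sides is the square supplied.
    nlinarith [sq_nonneg (covOU h0 h1' T t - 2 * ouCov H (t - T))]
  rw [intervalIntegral.integral_add i1 i2, intervalIntegral.integral_const_mul,
    intervalIntegral.integral_const_mul] at h
  have e1 := integral_ouCov_sq_shift_le h0 h1 hT T
  have e2 := mul_le_mul_of_nonneg_left (integral_exp_neg_le T)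
    (by positivity : 0 ≤ 18 * ouCov H 0 ^ 2)
  linarith

lemma abs_integral_covOU_sq_sub_le (h0 : 0 < H) (h1 : H < 3 / 4) (h1' : H < 1) {T : ℝ}
    (hT : 0 ≤ T) :
    |(∫ s in (0 : ℝ)..T, ∫ t in (0 : ℝ)..T, covOU h0 h1' s t ^ 2)
      - ∫ s in (0 : ℝ)..T, ∫ t in (0 : ℝ)..T, ouCov H (t - s) ^ 2|
      ≤ 10 * covSqMass H + 5 * ouCov H 0 ^ 2 := by
  have hc := continuous_ouCov h0 h1'
  have hρ : Continuous (Function.uncurry fun s t => covOU h0 h1' s t ^ 2) :=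
    (continuous_covOU h0 h1').pow 2
  have hr : Continuous (Function.uncurry fun s t => ouCov H (t - s) ^ 2) := by
    unfold Function.uncurry
    fun_prop
  -- The inner integral of `P` is at most `5 e^(-s) ∫ r²`. `P` occurs once in each order of its
  -- arguments, whence `10 ∫ r²`; the term `E` accounts for `5 r(0)²`.
  set P : ℝ → ℝ → ℝ := fun s t => Real.exp (-s) * (4 * ouCov H t ^ 2 + ouCov H (t - s) ^ 2)
    with hP
  have hPc : Continuous (Function.uncurry P) := by
    unfold Function.uncurry
    simp only [hP]
    fun_prop
  have hPc' : Continuous (Function.uncurry fun s t => P t s) := hPc.comp continuous_swap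
  set E : ℝ → ℝ → ℝ := fun s t => 5 * ouCov H 0 ^ 2 * Real.exp (-s) * Real.exp (-t) with hE
  have hEc : Continuous (Function.uncurry E) := by
    unfold Function.uncurry
    simp only [hE]
    fun_prop
  have hin : ∀ {f : ℝ → ℝ → ℝ}, Continuous (Function.uncurry f) → ∀ s,
      IntervalIntegrable (f s) volume 0 T := fun hf s =>
    Continuous.intervalIntegrable (hf.comp (continuous_const.prodMk continuous_id)) _ _
  have hout : ∀ {f : ℝ → ℝ → ℝ}, Continuous (Function.uncurry f) →
      IntervalIntegrable (fun s => ∫ t in (0 : ℝ)..T, f s t) volume 0 T := fun hf =>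
    Continuous.intervalIntegrable
      (intervalIntegral.continuous_parametric_intervalIntegral_of_continuous' hf 0 T) _ _
  have hptw : ∀ s ∈ Set.Ioc 0 T, ∀ t ∈ Set.Ioc 0 T,
      ‖covOU h0 h1' s t ^ 2 - ouCov H (t - s) ^ 2‖ ≤ P t s + P s t + E s t := by
    intro s hs t ht
    rw [covOU_eq h0 h1' hs.1.le ht.1.le, Real.norm_eq_abs]
    refine (abs_sq_sub_sq_le_of_perturbation (Real.exp_pos (-t)).le
      (Real.exp_le_one_iff.2 (by linarith [ht.1])) (Real.exp_pos (-s)).le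
      (Real.exp_le_one_iff.2 (by linarith [hs.1])) (abs_ouCov_le h0 h1' (t - s))).trans_eq ?_
    simp only [hP, hE]
    rw [← ouCov_neg (t - s), neg_sub]
    ring
  have hI : ∫ s in (0 : ℝ)..T, ∫ t in (0 : ℝ)..T, P s t ≤ 5 * covSqMass H := by
    calc ∫ s in (0 : ℝ)..T, ∫ t in (0 : ℝ)..T, P s t
        ≤ ∫ s in (0 : ℝ)..T, 5 * covSqMass H * Real.exp (-s) := by
          refine intervalIntegral.integral_mono_on hT (hout hPc)
            (Continuous.intervalIntegrable (by fun_prop) _ _) fun s _ => ?_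
          simp only [hP]
          rw [intervalIntegral.integral_const_mul, intervalIntegral.integral_add
            (Continuous.intervalIntegrable (by fun_prop) _ _)
            (Continuous.intervalIntegrable (by fun_prop) _ _),
            intervalIntegral.integral_const_mul, mul_comm]
          have e1 := integral_ouCov_sq_shift_le h0 h1 hT s
          have e2 := integral_ouCov_sq_shift_le h0 h1 hT 0
          simp only [sub_zero] at e2
          have := (Real.exp_pos (-s)).le
          gcongr
          linarith
      _ ≤ 5 * covSqMass H * 1 := by
          rw [intervalIntegral.integral_const_mul]
          have := covSqMass_nonneg (H := H)
          gcongr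
          exact integral_exp_neg_le T
      _ = _ := mul_one _
  have hI' : ∫ s in (0 : ℝ)..T, ∫ t in (0 : ℝ)..T, P t s ≤ 5 * covSqMass H := by
    rw [intervalIntegral_swap hPc' hT]
    exact hI
  have hIE : ∫ s in (0 : ℝ)..T, ∫ t in (0 : ℝ)..T, E s t ≤ 5 * ouCov H 0 ^ 2 := by
    simp only [hE, intervalIntegral.integral_const_mul, intervalIntegral.integral_mul_const]
    have e1 := integral_exp_neg_le T
    have e0 : 0 ≤ ∫ t in (0 : ℝ)..T, Real.exp (-t) :=
      intervalIntegral.integral_nonneg hT fun _ _ => (Real.exp_pos _).le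
    calc 5 * ouCov H 0 ^ 2 * (∫ t in (0 : ℝ)..T, Real.exp (-t)) * ∫ t in (0 : ℝ)..T, Real.exp (-t)
        ≤ 5 * ouCov H 0 ^ 2 * 1 * 1 := by gcongr
      _ = _ := by ring
  rw [← intervalIntegral.integral_sub (hout hρ) (hout hr), ← Real.norm_eq_abs]
  refine (intervalIntegral.norm_integral_le_of_norm_le hT
    (g := fun s => (∫ t in (0 : ℝ)..T, P t s) + (∫ t in (0 : ℝ)..T, P s t)
      + ∫ t in (0 : ℝ)..T, E s t)
    (Eventually.of_forall fun s hs => ?_) (((hout hPc').add (hout hPc)).add (hout hEc))).trans ?_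
  · rw [← intervalIntegral.integral_sub (hin hρ s) (hin hr s)]
    refine (intervalIntegral.norm_integral_le_of_norm_le hT
      (Eventually.of_forall fun t ht => hptw s hs t ht)
      (((hin hPc' s).add (hin hPc s)).add (hin hEc s))).trans_eq ?_
    rw [intervalIntegral.integral_add (f := fun t => P t s + P s t) ((hin hPc' s).add (hin hPc s))
      (hin hEc s), intervalIntegral.integral_add (hin hPc' s) (hin hPc s)]
  · rw [intervalIntegral.integral_add (f := fun s => (∫ t in (0 : ℝ)..T, P t s)
      + ∫ t in (0 : ℝ)..T, P s t) ((hout hPc').add (hout hPc)) (hout hEc),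
      intervalIntegral.integral_add (hout hPc') (hout hPc)]
    linarith

/-- The tail `∫_s^∞ r²`. -/
def covSqTail (H s : ℝ) : ℝ := ∫ u in Set.Ioi s, ouCov H u ^ 2

lemma two_mul_covSqTail_zero : 2 * covSqTail H 0 = covSqMass H := by
  rw [covSqMass, covSqTail, ← integral_comp_abs (f := fun u => ouCov H u ^ 2)]
  refine integral_congr_ae (Eventually.of_forall fun u => ?_)
  rcases abs_cases u with ⟨h, _⟩ | ⟨h, _⟩ <;> simp [h, ouCov_neg]

lemma covSqTail_eq (h0 : 0 < H) (h1 : H < 3 / 4) (s : ℝ) :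
    covSqTail H s = covSqTail H 0 - ∫ u in (0 : ℝ)..s, ouCov H u ^ 2 := by
  have h := integrable_ouCov_sq h0 h1
  rw [covSqTail, covSqTail, ← intervalIntegral.integral_interval_add_Ioi
    (h.integrableOn (s := Set.Ioi 0)) (h.integrableOn (s := Set.Ioi s))]
  ring

lemma covSqTail_nonneg (s : ℝ) : 0 ≤ covSqTail H s := integral_nonneg fun _ => sq_nonneg _

lemma covSqTail_le (h0 : 0 < H) (h1 : H < 3 / 4) (s : ℝ) : covSqTail H s ≤ covSqMass H :=
  setIntegral_le_integral (integrable_ouCov_sq h0 h1) (Eventually.of_forall fun _ => sq_nonneg _)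

lemma continuous_covSqTail (h0 : 0 < H) (h1 : H < 3 / 4) : Continuous (covSqTail H) := by
  have hc : Continuous fun u => ouCov H u ^ 2 := (continuous_ouCov h0 (by linarith)).pow 2
  rw [funext (covSqTail_eq h0 h1)]
  exact continuous_const.sub
    (intervalIntegral.continuous_primitive (fun a b => hc.intervalIntegrable a b) 0)

/-- For fixed `s` the window `[-s, T-s]` misses the two tails beyond `s` and `T-s`; the reflection
`s ↦ T-s` makes their integrals equal. -/
lemma integral_integral_ouCov_sq (h0 : 0 < H) (h1 : H < 3 / 4) (T : ℝ) :
    ∫ s in (0 : ℝ)..T, ∫ t in (0 : ℝ)..T, ouCov H (t - s) ^ 2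
      = T * covSqMass H - 2 * ∫ s in (0 : ℝ)..T, covSqTail H s := by
  have hc : Continuous fun u => ouCov H u ^ 2 := (continuous_ouCov h0 (by linarith)).pow 2
  have hQ := continuous_covSqTail h0 h1
  have hin : ∀ s, ∫ t in (0 : ℝ)..T, ouCov H (t - s) ^ 2
      = covSqMass H - covSqTail H s - covSqTail H (T - s) := by
    intro s
    rw [intervalIntegral.integral_comp_sub_right (fun u => ouCov H u ^ 2), zero_sub,
      ← intervalIntegral.integral_add_adjacent_intervals
        (hc.intervalIntegrable (-s) 0) (hc.intervalIntegrable 0 (T - s))]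
    have : ∫ u in (-s)..0, ouCov H u ^ 2 = ∫ u in (0 : ℝ)..s, ouCov H u ^ 2 := by
      have := intervalIntegral.integral_comp_neg (a := 0) (b := s) (fun u => ouCov H u ^ 2)
      simp only [ouCov_neg, neg_zero] at this
      exact this.symm
    rw [this, covSqTail_eq h0 h1 s, covSqTail_eq h0 h1 (T - s), ← two_mul_covSqTail_zero]
    ring
  simp_rw [hin]
  rw [intervalIntegral.integral_sub (f := fun s => covSqMass H - covSqTail H s)
    (Continuous.intervalIntegrable (by fun_prop) _ _)
    (Continuous.intervalIntegrable (by fun_prop) _ _),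
    intervalIntegral.integral_sub (Continuous.intervalIntegrable (by fun_prop) _ _)
    (Continuous.intervalIntegrable (by fun_prop) _ _), intervalIntegral.integral_const,
    intervalIntegral.integral_comp_sub_left (covSqTail H)]
  simp
  ring

lemma covSqTail_le_rpow {B e : ℝ} (he : e < 0)
    (hB : ∀ u, 0 < u → ouCov H u ^ 2 ≤ B * u ^ (e - 1)) {s : ℝ} (hs : 0 < s) :
    covSqTail H s ≤ B / (-e) * s ^ e := by
  have hi : IntegrableOn (fun u : ℝ => B * u ^ (e - 1)) (Set.Ioi s) :=
    (integrableOn_Ioi_rpow_of_lt (by linarith) hs).const_mul B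
  have h := norm_integral_le_of_norm_le (f := fun u => ouCov H u ^ 2) hi (by
    filter_upwards [ae_restrict_mem measurableSet_Ioi] with u hu
    rw [Real.norm_of_nonneg (sq_nonneg _)]
    exact hB u (hs.trans hu))
  refine (le_abs_self _).trans (h.trans_eq ?_)
  rw [integral_const_mul, integral_Ioi_rpow_of_lt (by linarith) hs, sub_add_cancel]
  field_simp

/-- On `[0,1]` the tail is bounded by the total mass, on `[1,T]` by a power of `s`. The exponent `κ`
dominates both the bounded part and `T^(e+1)`. -/
lemma integral_covSqTail_le (h0 : 0 < H) (h1 : H < 3 / 4) {B e κ : ℝ} (he : e < 0) (he1 : e ≠ -1)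
    (hκ : 0 ≤ κ) (heκ : e + 1 ≤ κ) (hB : ∀ u, 0 < u → ouCov H u ^ 2 ≤ B * u ^ (e - 1))
    {T : ℝ} (hT : 1 ≤ T) :
    ∫ s in (0 : ℝ)..T, covSqTail H s ≤ (covSqMass H + B / (-e) / |e + 1|) * T ^ κ := by
  have hQ := continuous_covSqTail h0 h1
  have hT0 : 0 < T := by linarith
  have hB0 : 0 ≤ B := by
    have := hB 1 one_pos
    rw [Real.one_rpow, mul_one] at this
    exact (sq_nonneg _).trans this
  have hTκ : 1 ≤ T ^ κ := Real.one_le_rpow hT hκ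
  have hA := covSqMass_nonneg (H := H)
  have h01 : ∫ s in (0 : ℝ)..1, covSqTail H s ≤ covSqMass H := by
    have := intervalIntegral.integral_mono_on zero_le_one (hQ.intervalIntegrable (μ := volume) 0 1)
      (continuous_const.intervalIntegrable 0 1) fun s _ => covSqTail_le h0 h1 s
    simpa using this
  have h0mem : (0 : ℝ) ∉ Set.uIcc 1 T := by
    rw [Set.uIcc_of_le hT]
    exact fun h => absurd h.1 (by norm_num)
  have hb0 : 0 ≤ B / (-e) := div_nonneg hB0 (by linarith)
  have h1T : ∫ s in (1 : ℝ)..T, covSqTail H s ≤ B / (-e) / |e + 1| * T ^ κ := by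
    have hm := intervalIntegral.integral_mono_on hT (hQ.intervalIntegrable (μ := volume) 1 T)
      ((intervalIntegral.intervalIntegrable_rpow (μ := volume) (r := e) (Or.inr h0mem)).const_mul
        (B / (-e)))
      fun s hs => covSqTail_le_rpow he hB (by linarith [hs.1] : 0 < s)
    rw [intervalIntegral.integral_const_mul, integral_rpow (Or.inr ⟨he1, h0mem⟩),
      Real.one_rpow] at hm
    refine hm.trans ?_
    rw [show B / (-e) / |e + 1| * T ^ κ = B / (-e) * (T ^ κ / |e + 1|) by ring]
    refine mul_le_mul_of_nonneg_left ?_ hb0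
    refine (le_abs_self _).trans ?_
    rw [abs_div]
    gcongr
    have hTe : T ^ (e + 1) ≤ T ^ κ := Real.rpow_le_rpow_of_exponent_le hT heκ
    have hTe0 : 0 < T ^ (e + 1) := Real.rpow_pos_of_pos hT0 _
    rw [abs_le]
    constructor <;> linarith
  rw [← intervalIntegral.integral_add_adjacent_intervals (hQ.intervalIntegrable 0 1)
    (hQ.intervalIntegrable 1 T)]
  nlinarith

/-- The rate exponent `1 ∧ (3 - 4H)`. -/
abbrev rate (H : ℝ) : ℝ := min 1 (3 - 4 * H)

lemma exists_integral_covSqTail_le (h0 : 0 < H) (h1 : H < 3 / 4) :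
    ∃ K : ℝ, ∀ T : ℝ, 1 ≤ T → ∫ s in (0 : ℝ)..T, covSqTail H s ≤ K * T ^ (1 - rate H) := by
  have hκ : 0 ≤ 1 - rate H := sub_nonneg.2 (min_le_left _ _)
  -- At `H = 1/2` the general exponent `4H - 3` equals `-1`, whose primitive is a logarithm; the
  -- sharper decay `u^(-2)` allows `e = -3`.
  rcases eq_or_ne H (1 / 2) with rfl | hH
  · refine ⟨_, fun T hT => integral_covSqTail_le h0 h1 (B := 9) (e := -3) (by norm_num)
      (by norm_num) hκ (by linarith) (fun u hu => ?_) hT⟩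
    have h := abs_ouCov_half_le hu
    rw [← sq_abs]
    calc |ouCov (1 / 2) u| ^ 2 ≤ (3 * u ^ (-2 : ℝ)) ^ 2 := by gcongr
      _ = 9 * u ^ ((-3 : ℝ) - 1) := by
        rw [mul_pow, ← Real.rpow_mul_natCast hu.le]
        norm_num
  · refine ⟨_, fun T hT => integral_covSqTail_le h0 h1 (B := 1) (e := 4 * H - 3) (by linarith)
      (fun h => hH (by linarith)) hκ ?_ (fun u hu => ?_) hT⟩
    · have := min_le_right 1 (3 - 4 * H)
      linarith
    · have h := abs_ouCov_le_rpow h0 (by linarith) hu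
      rw [← sq_abs, one_mul]
      calc |ouCov H u| ^ 2 ≤ (u ^ (2 * H - 2)) ^ 2 := by gcongr
        _ = u ^ (4 * H - 3 - 1) := by
          rw [← Real.rpow_mul_natCast hu.le]
          congr 1
          push_cast
          ring

/-! ### Short horizons and the final rate -/

lemma norm_featL (h0 : 0 < H) (h1 : H < 1) {s : ℝ} (hs : 0 ≤ s) : ‖featL h0 h1 s‖ = s ^ H := by
  rw [← sq_eq_sq₀ (norm_nonneg _) (by positivity), ← real_inner_self_eq_norm_sq, inner_featL,
    covAll, sub_self, abs_zero, Real.zero_rpow (by positivity), abs_of_nonneg hs,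
    ← Real.rpow_mul_natCast hs]
  push_cast
  rw [mul_comm H]
  ring

lemma norm_hFeat_le (h0 : 0 < H) (h1 : H < 1) {t T : ℝ} (ht : 0 ≤ t) (htT : t ≤ T) (hT : T ≤ 1) :
    ‖hFeat h0 h1 t‖ ≤ 2 * T ^ H := by
  have hT0 : 0 ≤ T := ht.trans htT
  have hle : ∀ s, 0 ≤ s → s ≤ t → ‖featL h0 h1 s‖ ≤ T ^ H := fun s hs hst => by
    rw [norm_featL h0 h1 hs]
    exact Real.rpow_le_rpow hs (hst.trans htT) h0.le
  have hint : ‖∫ s in (0 : ℝ)..t, Real.exp (s - t) • featL h0 h1 s‖ ≤ T ^ H * |t - 0| := by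
    refine intervalIntegral.norm_integral_le_of_norm_le_const fun s hs => ?_
    rw [Set.uIoc_of_le ht] at hs
    rw [norm_smul, Real.norm_of_nonneg (Real.exp_pos _).le]
    calc Real.exp (s - t) * ‖featL h0 h1 s‖ ≤ 1 * T ^ H :=
          mul_le_mul (Real.exp_le_one_iff.2 (by linarith [hs.2])) (hle s hs.1.le hs.2)
            (norm_nonneg _) zero_le_one
      _ = _ := one_mul _
  rw [sub_zero, abs_of_nonneg ht] at hint
  have hTH : 0 ≤ T ^ H := by positivity
  calc ‖hFeat h0 h1 t‖ ≤ T ^ H + T ^ H * t := (norm_sub_le _ _).trans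
        (add_le_add (hle t ht le_rfl) hint)
    _ ≤ T ^ H + T ^ H * 1 := by gcongr; linarith
    _ = _ := by ring

lemma covOU_sq_le (h0 : 0 < H) (h1 : H < 1) {s t T : ℝ} (hs : s ∈ Set.Icc 0 T)
    (ht : t ∈ Set.Icc 0 T) (hT : T ≤ 1) : covOU h0 h1 s t ^ 2 ≤ 16 * T ^ (4 * H) := by
  have hT0 : 0 ≤ T := hs.1.trans hs.2
  have h := abs_real_inner_le_norm (hFeat h0 h1 s) (hFeat h0 h1 t)
  rw [← sq_abs, show T ^ (4 * H) = (T ^ H) ^ 4 by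
    rw [← Real.rpow_mul_natCast hT0]; congr 1; push_cast; ring]
  calc |covOU h0 h1 s t| ^ 2 ≤ (‖hFeat h0 h1 s‖ * ‖hFeat h0 h1 t‖) ^ 2 := by
        gcongr
        exact h
    _ ≤ ((2 * T ^ H) * (2 * T ^ H)) ^ 2 := by
        gcongr
        · exact norm_hFeat_le h0 h1 hs.1 hs.2 hT
        · exact norm_hFeat_le h0 h1 ht.1 ht.2 hT
    _ = _ := by ring

lemma sqNormF_nonneg (h0 : 0 < H) (h1 : H < 1) (T : ℝ) : 0 ≤ sqNormF h0 h1 T := by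
  rw [← norm_sq_fVec_snd]
  positivity

lemma sqNormF_le_of_le_one (h0 : 0 < H) (h1 : H < 1) {T : ℝ} (hT0 : 0 ≤ T) (hT : T ≤ 1) :
    sqNormF h0 h1 T ≤ 144 * T ^ (4 * H) := by
  have hb : 0 ≤ 16 * T ^ (4 * H) := by positivity
  have hTm : T ∈ Set.Icc 0 T := ⟨hT0, le_rfl⟩
  have hin : ∀ s ∈ Set.Icc 0 T, ∫ t in (0 : ℝ)..T, covOU h0 h1 s t ^ 2 ≤ 16 * T ^ (4 * H) := by
    intro s hs
    have := intervalIntegral.integral_mono_on hT0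
      (((continuous_covOU_right h0 h1 s).pow 2).intervalIntegrable (μ := volume) 0 T)
      (continuous_const.intervalIntegrable 0 T) fun t ht => covOU_sq_le h0 h1 hs ht hT
    rw [intervalIntegral.integral_const, sub_zero, smul_eq_mul] at this
    exact this.trans (mul_le_of_le_one_left hb hT)
  have hρ : Continuous (Function.uncurry fun s t => covOU h0 h1 s t ^ 2) :=
    (continuous_covOU h0 h1).pow 2
  have hdbl : ∫ s in (0 : ℝ)..T, ∫ t in (0 : ℝ)..T, covOU h0 h1 s t ^ 2
      ≤ 16 * T ^ (4 * H) := by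
    have := intervalIntegral.integral_mono_on hT0
      ((intervalIntegral.continuous_parametric_intervalIntegral_of_continuous' (μ := volume)
        hρ 0 T).intervalIntegrable (μ := volume) 0 T)
      (continuous_const.intervalIntegrable 0 T) hin
    rw [intervalIntegral.integral_const, sub_zero, smul_eq_mul] at this
    exact this.trans (mul_le_of_le_one_left hb hT)
  have h1 := covOU_sq_le h0 h1 hTm hTm hT
  have h2 := hin T hTm
  -- `144 = (1 + 4 + 4) · 16`.
  unfold sqNormF
  linarith

lemma le_div_rpow {X c a T : ℝ} (hc : 0 ≤ c) (ha : 0 ≤ a) (ha1 : a ≤ 1) (hT : 0 < T) (h1 : X ≤ c)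
    (h2 : X ≤ c / T) : X ≤ c / T ^ a := by
  rcases le_total T 1 with h | h
  · refine h1.trans ?_
    rw [le_div_iff₀ (by positivity)]
    exact mul_le_of_le_one_right hc (Real.rpow_le_one hT.le h ha)
  · refine h2.trans (div_le_div_of_nonneg_left hc (by positivity) ?_)
    have := Real.rpow_le_rpow_of_exponent_le h ha1
    rwa [Real.rpow_one] at this

theorem exists_abs_sqNormF_sub_le (h0 : 0 < H) (h1 : H < 3 / 4) (h1' : H < 1) :
    ∃ K : ℝ, 0 ≤ K ∧ ∀ T : ℝ, 0 < T →
      |sqNormF h0 h1' T / (2 * T) - 2 * covSqMass H| ≤ K / T ^ rate H := by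
  obtain ⟨K, hK⟩ := exists_integral_covSqTail_le h0 h1
  have ha : 0 < rate H := lt_min one_pos (by linarith)
  have ha1 : rate H ≤ 1 := min_le_left _ _
  have hA := covSqMass_nonneg (H := H)
  have hr := (ouCov_zero_pos h0 h1').le
  -- The first two terms serve `T ≤ 1`. For `T ≥ 1`, `2L` has to dominate `48 ∫ r² + 108 r(0)² +
  -- 8|K|`, where `48 = 4·2 + 4·10` and `108 = 16 + 4·18 + 4·5`.
  set L : ℝ := 72 + 2 * covSqMass H + (32 * covSqMass H + 54 * ouCov H 0 ^ 2) + 4 * |K| with hL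
  refine ⟨L, by positivity, fun T hT => ?_⟩
  have hTa : 0 < T ^ rate H := by positivity
  rcases le_total T 1 with hT1 | hT1
  · have hn := sqNormF_nonneg h0 h1' T
    have hle := sqNormF_le_of_le_one h0 h1' hT.le hT1
    have e1 : sqNormF h0 h1' T / (2 * T) ≤ 72 / T ^ rate H := by
      -- `1 - rate H` is `0` or `4H - 2`, in both cases at most `4H`, and `T ≤ 1` reverses the order
      -- of powers.
      have hexp : T ^ (4 * H) ≤ T ^ (1 - rate H) := by
        refine Real.rpow_le_rpow_of_exponent_ge hT hT1 ?_
        rcases min_cases 1 (3 - 4 * H) with ⟨h, _⟩ | ⟨h, _⟩ <;> rw [rate, h] <;> linarith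
      rw [Real.rpow_sub hT, Real.rpow_one] at hexp
      calc sqNormF h0 h1' T / (2 * T) ≤ 144 * (T / T ^ rate H) / (2 * T) := by
            gcongr
            exact hle.trans (by gcongr)
        _ = _ := by field_simp; norm_num
    have e2 : 2 * covSqMass H ≤ 2 * covSqMass H / T ^ rate H := by
      rw [le_div_iff₀ hTa]
      exact mul_le_of_le_one_right (by positivity) (Real.rpow_le_one hT.le hT1 ha.le)
    have e3 : 72 / T ^ rate H + 2 * covSqMass H / T ^ rate H ≤ L / T ^ rate H := by
      rw [← add_div]
      gcongr
      have : 0 ≤ 32 * covSqMass H + 54 * ouCov H 0 ^ 2 + 4 * |K| := by positivity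
      linarith
    have e4 : 0 ≤ sqNormF h0 h1' T / (2 * T) := by positivity
    have e5 : 0 ≤ 72 / T ^ rate H := by positivity
    rw [abs_le]
    constructor <;> linarith
  · have b1 : covOU h0 h1' T T ^ 2 ≤ 16 * ouCov H 0 ^ 2 := by
      have hd := abs_covOU_sub_le h0 h1' hT.le le_rfl
      rw [sub_self] at hd
      have he : Real.exp (-T) ≤ 1 := Real.exp_le_one_iff.2 (by linarith)
      have he' : 3 * ouCov H 0 * Real.exp (-T) ≤ 3 * ouCov H 0 :=
        mul_le_of_le_one_right (by positivity) he
      have hab : |covOU h0 h1' T T| ≤ 4 * ouCov H 0 := by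
        rw [abs_le] at hd ⊢
        constructor <;> linarith
      rw [← sq_abs]
      calc |covOU h0 h1' T T| ^ 2 ≤ (4 * ouCov H 0) ^ 2 := by gcongr
        _ = _ := by ring
    have b2 := integral_covOU_sq_le h0 h1 h1' hT.le
    have b2' : 0 ≤ ∫ t in (0 : ℝ)..T, covOU h0 h1' T t ^ 2 :=
      intervalIntegral.integral_nonneg hT.le fun _ _ => sq_nonneg _
    have b3 := abs_integral_covOU_sq_sub_le h0 h1 h1' hT.le
    rw [integral_integral_ouCov_sq h0 h1] at b3
    have b4 := hK T hT1
    have b4' : 0 ≤ ∫ s in (0 : ℝ)..T, covSqTail H s :=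
      intervalIntegral.integral_nonneg hT.le fun _ _ => covSqTail_nonneg _
    have hTκ : 1 ≤ T ^ (1 - rate H) := Real.one_le_rpow hT1 (by linarith)
    have b4'' : ∫ s in (0 : ℝ)..T, covSqTail H s ≤ |K| * T ^ (1 - rate H) :=
      b4.trans (by gcongr; exact le_abs_self K)
    have hnum : |sqNormF h0 h1' T - 4 * (T * covSqMass H)|
        ≤ 2 * L * T ^ (1 - rate H) := by
      have hS : |sqNormF h0 h1' T - 4 * (T * covSqMass H)|
          ≤ 48 * covSqMass H + 108 * ouCov H 0 ^ 2 + 8 * (|K| * T ^ (1 - rate H)) := by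
        unfold sqNormF
        have := sq_nonneg (covOU h0 h1' T T)
        have := sq_nonneg (ouCov H 0)
        rw [abs_le] at b3 ⊢
        constructor <;> linarith
      refine hS.trans ?_
      have hc0 : 0 ≤ 48 * covSqMass H + 108 * ouCov H 0 ^ 2 := by positivity
      have hc1 : 48 * covSqMass H + 108 * ouCov H 0 ^ 2
          ≤ (48 * covSqMass H + 108 * ouCov H 0 ^ 2) * T ^ (1 - rate H) :=
        le_mul_of_one_le_right hc0 hTκ
      have hc2 : (48 * covSqMass H + 108 * ouCov H 0 ^ 2 + 8 * |K|) * T ^ (1 - rate H)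
          ≤ 2 * L * T ^ (1 - rate H) := by
        gcongr
        linarith
      linarith
    have hdiv : sqNormF h0 h1' T / (2 * T) - 2 * covSqMass H
        = (sqNormF h0 h1' T - 4 * (T * covSqMass H)) / (2 * T) := by
      field_simp
      ring
    rw [hdiv, abs_div, abs_of_pos (by positivity : 0 < 2 * T), div_le_iff₀ (by positivity)]
    refine hnum.trans_eq ?_
    rw [Real.rpow_sub hT, Real.rpow_one]
    field_simp

lemma normSqOne_hT (h0 : 0 < H) (h1 : H < 1) {T t : ℝ} (ht : t ∈ Set.Icc 0 T) :
    normSqOne H T (hT t) = covOU h0 h1 t t := by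
  have : {N | IsNormSqOne H T (hT t) N} = {covOU h0 h1 t t} :=
    Set.ext fun N => isNormSqOne_hT_iff h0 h1 ht N
  rw [normSqOne, this, csInf_singleton]

lemma normSqTwo_fT (h0 : 0 < H) (h1 : H < 1) {T : ℝ} (hT0 : 0 ≤ T) :
    normSqTwo H T (fT T) = sqNormF h0 h1 T := by
  have : {N | IsNormSqTwo H T (fT T) N} = {sqNormF h0 h1 T} :=
    Set.ext fun N => isNormSqTwo_fT_iff h0 h1 hT0 N
  rw [normSqTwo, this, csInf_singleton]

lemma continuous_covOU_diag (h0 : 0 < H) (h1 : H < 1) : Continuous fun t => covOU h0 h1 t t := by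
  unfold covOU
  exact (continuous_hFeat h0 h1).inner (continuous_hFeat h0 h1)

lemma intervalIntegrable_normSqOne (h0 : 0 < H) (h1 : H < 1) {T : ℝ} (hT0 : 0 ≤ T) :
    IntervalIntegrable (fun t => normSqOne H T (hT t)) volume 0 T := by
  refine ((continuous_covOU_diag h0 h1).intervalIntegrable 0 T).congr fun t ht => ?_
  rw [Set.uIoc_of_le hT0] at ht
  exact (normSqOne_hT h0 h1 (Set.Ioc_subset_Icc_self ht)).symm

lemma bT_eq (h0 : 0 < H) (h1 : H < 1) {T : ℝ} (hT0 : 0 ≤ T) :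
    bT H T = (1 / T) * ∫ t in (0 : ℝ)..T, covOU h0 h1 t t := by
  rw [bT]
  congr 1
  refine intervalIntegral.integral_congr fun t ht => ?_
  rw [Set.uIcc_of_le hT0] at ht
  exact normSqOne_hT h0 h1 ht

/-- The integrand differs from `r(0)` by at most `3 r(0) e^(-t)`, which is both bounded and
integrable: the averages are within `3 r(0)` and within `3 r(0)/T`, and these bounds interpolate to
any exponent `a ∈ [0,1]`. -/
lemma abs_bT_sub_le (h0 : 0 < H) (h1 : H < 1) {T a : ℝ} (hT : 0 < T) (ha : 0 ≤ a) (ha1 : a ≤ 1) :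
    |bT H T - ouCov H 0| ≤ 3 * ouCov H 0 ∧ |bT H T - ouCov H 0| ≤ 3 * ouCov H 0 / T ^ a := by
  have hr := (ouCov_zero_pos h0 h1).le
  have hc := continuous_covOU_diag h0 h1
  have hptw : ∀ t, 0 ≤ t → ‖covOU h0 h1 t t - ouCov H 0‖ ≤ 3 * ouCov H 0 * Real.exp (-t) := by
    intro t ht
    have := abs_covOU_sub_le h0 h1 ht le_rfl
    rwa [sub_self] at this
  have heq : bT H T - ouCov H 0 = (∫ t in (0 : ℝ)..T, (covOU h0 h1 t t - ouCov H 0)) / T := by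
    rw [bT_eq h0 h1 hT.le, intervalIntegral.integral_sub (hc.intervalIntegrable _ _)
      (continuous_const.intervalIntegrable _ _), intervalIntegral.integral_const, sub_zero,
      smul_eq_mul]
    field_simp
  have e1 : ‖∫ t in (0 : ℝ)..T, (covOU h0 h1 t t - ouCov H 0)‖ ≤ 3 * ouCov H 0 := by
    refine (intervalIntegral.norm_integral_le_of_norm_le hT.le
      (g := fun t => 3 * ouCov H 0 * Real.exp (-t))
      (Eventually.of_forall fun t ht => hptw t ht.1.le)
      (Continuous.intervalIntegrable (by fun_prop) _ _)).trans ?_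
    rw [intervalIntegral.integral_const_mul]
    exact mul_le_of_le_one_right (by positivity) (integral_exp_neg_le T)
  have e2 : ‖∫ t in (0 : ℝ)..T, (covOU h0 h1 t t - ouCov H 0)‖ ≤ 3 * ouCov H 0 * |T - 0| := by
    refine intervalIntegral.norm_integral_le_of_norm_le_const fun t ht => ?_
    rw [Set.uIoc_of_le hT.le] at ht
    exact (hptw t ht.1.le).trans (mul_le_of_le_one_right (by positivity)
      (Real.exp_le_one_iff.2 (by linarith [ht.1])))
  rw [sub_zero, abs_of_pos hT] at e2
  have f1 : |bT H T - ouCov H 0| ≤ 3 * ouCov H 0 := by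
    rw [heq, abs_div, abs_of_pos hT, div_le_iff₀ hT]
    exact e2
  have f2 : |bT H T - ouCov H 0| ≤ 3 * ouCov H 0 / T := by
    rw [heq, abs_div, abs_of_pos hT]
    gcongr
    exact e1
  exact ⟨f1, le_div_rpow (by positivity) ha ha1 hT f1 f2⟩

theorem exists_rate (h0 : 0 < H) (h1 : H < 3 / 4) :
    ∃ C : ℝ, 0 < C ∧ ∀ T : ℝ, 0 < T →
      |normSqTwo H T (fT T) / (2 * T) - sigmaSq H * bT H T ^ 2| ≤ C / T ^ rate H := by
  have h1' : H < 1 := by linarith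
  obtain ⟨K, hK0, hK⟩ := exists_abs_sqNormF_sub_le h0 h1 h1'
  have ha : 0 < rate H := lt_min one_pos (by linarith)
  have hr := (ouCov_zero_pos h0 h1').le
  -- `15 = 3 · 5` comes from factoring `b_T² - r(0)²`, with `|b_T + r(0)| ≤ 5 r(0)`; the summand `1`
  -- only makes the constant positive.
  refine ⟨K + |sigmaSq H| * (15 * ouCov H 0 ^ 2) + 1, by positivity, fun T hT => ?_⟩
  have hTa : 0 < T ^ rate H := by positivity
  obtain ⟨f1, f2⟩ := abs_bT_sub_le h0 h1' hT ha.le (min_le_left _ _)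
  have hconst : 2 * covSqMass H = sigmaSq H * ouCov H 0 ^ 2 := two_mul_integral_ouCov_sq h0 h1
  have hb : |sigmaSq H * (ouCov H 0 ^ 2 - bT H T ^ 2)|
      ≤ |sigmaSq H| * (15 * ouCov H 0 ^ 2) / T ^ rate H := by
    have hsum : |bT H T + ouCov H 0| ≤ 5 * ouCov H 0 := by
      rw [abs_le] at f1 ⊢
      constructor <;> linarith
    rw [abs_mul, show ouCov H 0 ^ 2 - bT H T ^ 2
      = -((bT H T - ouCov H 0) * (bT H T + ouCov H 0)) by ring, abs_neg, abs_mul, mul_div_assoc]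
    gcongr
    calc |bT H T - ouCov H 0| * |bT H T + ouCov H 0|
        ≤ (3 * ouCov H 0 / T ^ rate H) * (5 * ouCov H 0) := by gcongr
      _ = _ := by ring
  rw [normSqTwo_fT h0 h1' hT.le]
  calc |sqNormF h0 h1' T / (2 * T) - sigmaSq H * bT H T ^ 2|
      = |(sqNormF h0 h1' T / (2 * T) - 2 * covSqMass H)
          + sigmaSq H * (ouCov H 0 ^ 2 - bT H T ^ 2)| := by
        congr 1
        linear_combination hconst
    _ ≤ K / T ^ rate H + |sigmaSq H| * (15 * ouCov H 0 ^ 2) / T ^ rate H :=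
        (abs_add_le _ _).trans (add_le_add (hK T hT) hb)
    _ ≤ _ := by
        rw [← add_div]
        exact div_le_div_of_nonneg_right (by linarith) hTa.le

end Estimates

end FBM

end

theorem proposition2p1 (H : ℝ) (hH0 : 0 < H) (hH1 : H < 3 / 4) :
    ∃ C : ℝ, 0 < C ∧ ∀ T : ℝ, 0 < T →
      (∃! N : ℝ, FBM.IsNormSqTwo H T (FBM.fT T) N) ∧
      (∀ t ∈ Set.Icc (0 : ℝ) T, ∃! N : ℝ, FBM.IsNormSqOne H T (FBM.hT t) N) ∧
      IntervalIntegrable (fun t => FBM.normSqOne H T (FBM.hT t)) MeasureTheory.volume 0 T ∧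
      |FBM.normSqTwo H T (FBM.fT T) / (2 * T) - FBM.sigmaSq H * FBM.bT H T ^ 2|
        ≤ C / T ^ min 1 (3 - 4 * H) := by
  have h1 : H < 1 := by linarith
  obtain ⟨C, hC, hrate⟩ := FBM.exists_rate hH0 hH1
  refine ⟨C, hC, fun T hT => ⟨?_, fun t ht => ?_, ?_, hrate T hT⟩⟩
  · exact ⟨_, (FBM.isNormSqTwo_fT_iff hH0 h1 hT.le _).2 rfl,
      fun N hN => (FBM.isNormSqTwo_fT_iff hH0 h1 hT.le N).1 hN⟩
  · exact ⟨_, (FBM.isNormSqOne_hT_iff hH0 h1 ht _).2 rfl,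
      fun N hN => (FBM.isNormSqOne_hT_iff hH0 h1 ht N).1 hN⟩
  · exact FBM.intervalIntegrable_normSqOne hH0 h1 hT.le
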